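/- Let $A$ be a Polish space with its Borel $\sigma$-field. For a word $w=(w_1,\dots,w_{n+1})$ over $A$ and $i\in[n+1]=\{1,\dots,n+1\}$ let $\mathrm{erase}(w,i)$ be the word of length $n$ obtained by deleting the $i$-th letter. A *general erased-word process* (GEWP) over $A$ is a stochastic process $(W,\eta)=(W_n,\eta_n)_{n\ge 1}$ on a probability space $(\Omega,\mathcal A,\mathbb P)$ such that for each $n\ge 1$: (i) $W_n=(W_{n,1},\dots,W_{n,n})$ is a random word of length $n$ over $A$; (ii) $\eta_n$ is uniform on $[n]$ and independent of $\sigma(W_k,\eta_{k+1}:k\ge n)$; (iii) $W_n=\mathrm{erase}(W_{n+1},\eta_{n+1})$ almost surely. Let $\mathcal C(A)$ be the set of probability measures $\rho$ on $A\times\mathbb R$ with $\rho(A\times[0,t])=t$ for all $t\in[0,1]$. For such $\rho$ let $(Y_j,U_j)_{j\ge1}$ be i.i.d. with law $\rho$ and let $\mathrm{GL}(\rho)$ be the law on $\prod_{n\ge1}A^n\times[n]$ of the process whose $n$-th component is $\big((Y_{\pi_n(1)},\dots,Y_{\pi_n(n)}),\ \#\{k\in[n]:U_k\le U_n\}\big)$,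 where $\pi_n$ is the permutation of $[n]$ that sorts $U_1,\dots,U_n$ increasingly, with ties kept in their original order. For a word $w=(w_1,\dots,w_n)$ of length $n\ge1$ put $\rho_w=\frac1n\sum_{j=1}^n\delta_{(w_j,\,j/n)}$, a probability measure on $A\times\mathbb R$. **Statement.** Let $(W,\eta)$ be a GEWP over $A$. Then there is a random variable $\Xi$ on the same probability space with values in $\mathcal C(A)$ such that $\mathrm{Law}\big((W,\eta)\mid\Xi\big)=\mathrm{GL}(\Xi)$ almost surely, that is, $\mathrm{GL}(\Xi)$ is a regular conditional distribution of $(W,\eta)$ given $\sigma(\Xi)$. This $\Xi$, the random directing measure of $(W,\eta)$, is almost surely unique, and almost surely $\rho_{W_n}\to\Xi$ weakly as $n\to\infty$. -/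

import Mathlib

open MeasureTheory ProbabilityTheory Filter Topology

noncomputable section

namespace ErasedWord

/-! Words of length `n ≥ 1` over `A` are functions `Fin n → A`; the time `n ≥ 1` is the
index `n - 1 : ℕ`, and the position `i ∈ {1, …, n}` is the element `i - 1` of `Fin n`. -/

/-- The word obtained from `w` by erasing the letter at position `i`. -/
def eraseLetter {A : Type*} {n : ℕ} (w : Fin (n + 1) → A) (i : Fin (n + 1)) : Fin n → A :=
  fun j => w (i.succAbove j)

/-- The `σ`-field generated by the words `W k` and the erasers `η (k + 1)`, for all `k ≥ n`. -/
abbrev backwardField {Ω A : Type*} [MeasurableSpace A]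
    (W : (n : ℕ) → Ω → Fin (n + 1) → A) (η : (n : ℕ) → Ω → Fin (n + 1)) (n : ℕ) :
    MeasurableSpace Ω :=
  ⨆ k : ℕ, ⨆ _ : n ≤ k,
    (MeasurableSpace.comap (W k) inferInstance ⊔
      MeasurableSpace.comap (η (k + 1)) inferInstance)

/-- `(W, η)` is a general erased-word process over the alphabet `A`: `W n` is a random word of
length `n + 1`, and `η n` is uniform on the `n + 1` positions of that word. -/
structure IsGEWP {Ω A : Type*} [MeasurableSpace Ω] [MeasurableSpace A] (μ : Measure Ω)
    (W : (n : ℕ) → Ω → Fin (n + 1) → A) (η : (n : ℕ) → Ω → Fin (n + 1)) : Prop where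
  measurable_word : ∀ n, Measurable (W n)
  measurable_eraser : ∀ n, Measurable (η n)
  uniform : ∀ (n : ℕ) (i : Fin (n + 1)), μ {ω | η n ω = i} = ((n + 1 : ℕ) : ENNReal)⁻¹
  indep : ∀ n, Indep (MeasurableSpace.comap (η n) inferInstance) (backwardField W η n) μ
  erase : ∀ n, ∀ᵐ ω ∂μ, W n ω = eraseLetter (W (n + 1) ω) (η (n + 1) ω)

/-- The space `∏_{n ≥ 1} A^n × [n]` in which the pair `(W, η)` takes its values. -/
abbrev PathSpace (A : Type*) : Type _ := (n : ℕ) → (Fin (n + 1) → A) × Fin (n + 1)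

/-- The pair `(W, η)` as one random variable with values in the path space. -/
def path {Ω A : Type*} (W : (n : ℕ) → Ω → Fin (n + 1) → A) (η : (n : ℕ) → Ω → Fin (n + 1))
    (ω : Ω) : PathSpace A :=
  fun n => (W n ω, η n ω)

/-- The set `C(A)` of the laws of pairs `(Y, U)` on `A × ℝ` with `U` uniform on `[0, 1]`. -/
def uniformMarginal (A : Type*) [MeasurableSpace A] : Set (ProbabilityMeasure (A × ℝ)) :=
  {ρ | ∀ t ∈ Set.Icc (0 : ℝ) 1,
    (ρ : Measure (A × ℝ)) (Set.univ ×ˢ Set.Icc (0 : ℝ) t) = ENNReal.ofReal t}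

/-- Induced order statistics of `y` with respect to `x`: the letters of `y`, rearranged by the
stable permutation that sorts `x` increasingly. -/
def inducedOrderStat {A : Type*} {n : ℕ} (y : Fin n → A) (x : Fin n → ℝ) : Fin n → A :=
  fun i => y (Tuple.sort x i)

/-- The rank `#{k : x k ≤ x (last)}` of the last entry among `x 0, …, x n`. It lies in
`{1, …, n + 1}`; as a position it is the element `rank - 1` of `Fin (n + 1)`. -/
def lastRank {n : ℕ} (x : Fin (n + 1) → ℝ) : Fin (n + 1) :=
  ⟨(Finset.univ.filter fun k => x k ≤ x (Fin.last n)).card - 1, by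
    have h : (Finset.univ.filter fun k => x k ≤ x (Fin.last n)).card ≤ n + 1 := by
      simpa using Finset.card_le_univ (Finset.univ.filter fun k => x k ≤ x (Fin.last n))
    omega⟩

/-- The path of words and erasers built from a sequence of pairs `(y j, x j)`. -/
def pathOfSeq {A : Type*} (z : ℕ → A × ℝ) : PathSpace A :=
  fun n => (inducedOrderStat (fun k : Fin (n + 1) => (z k).1) (fun k => (z k).2),
    lastRank (fun k : Fin (n + 1) => (z k).2))

theorem measurableSet_sort_eq {n : ℕ} (σ : Equiv.Perm (Fin n)) :
    MeasurableSet {x : Fin n → ℝ | Tuple.sort x = σ} := by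
  have h : {x : Fin n → ℝ | Tuple.sort x = σ} =
      {x | ∀ i j, i ≤ j → x (σ i) ≤ x (σ j)} ∩
        {x | ∀ i j, i < j → x (σ i) = x (σ j) → σ i < σ j} := by
    ext x
    simp only [Set.mem_ofPred_eq, Set.mem_inter_iff]
    rw [eq_comm, Tuple.eq_sort_iff]
    rfl
  rw [h]
  refine MeasurableSet.inter ?_ ?_
  · simp only [Set.ofPred_forall]
    exact MeasurableSet.iInter fun i => MeasurableSet.iInter fun j => MeasurableSet.iInter fun _ =>
      measurableSet_le (measurable_pi_apply _) (measurable_pi_apply _)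
  · simp only [Set.ofPred_forall]
    refine MeasurableSet.iInter fun i => MeasurableSet.iInter fun j => MeasurableSet.iInter fun _ =>
      ?_
    exact MeasurableSet.imp (measurableSet_eq_fun (measurable_pi_apply _) (measurable_pi_apply _))
      (MeasurableSet.const _)

theorem measurable_inducedOrderStat {A : Type*} [MeasurableSpace A] (n : ℕ) :
    Measurable (fun p : (Fin n → A) × (Fin n → ℝ) => inducedOrderStat p.1 p.2) := by
  refine measurable_pi_lambda _ fun i => ?_
  intro B hB
  have h : (fun p : (Fin n → A) × (Fin n → ℝ) => inducedOrderStat p.1 p.2 i) ⁻¹' B =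
      ⋃ σ : Equiv.Perm (Fin n), {p | Tuple.sort p.2 = σ} ∩ {p | p.1 (σ i) ∈ B} := by
    ext p
    simp [inducedOrderStat]
  rw [h]
  refine MeasurableSet.iUnion fun σ => MeasurableSet.inter ?_ ?_
  · exact measurable_snd (measurableSet_sort_eq σ)
  · exact ((measurable_pi_apply (σ i)).comp measurable_fst) hB

theorem measurable_lastRank (n : ℕ) :
    Measurable (fun x : Fin (n + 1) → ℝ => lastRank x) := by
  have hcard : Measurable (fun x : Fin (n + 1) → ℝ =>
      (Finset.univ.filter fun k => x k ≤ x (Fin.last n)).card) := by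
    simp only [Finset.card_filter]
    refine Finset.measurable_sum _ fun k _ => ?_
    exact Measurable.ite (measurableSet_le (measurable_pi_apply _) (measurable_pi_apply _))
      measurable_const measurable_const
  refine measurable_to_countable' fun i => ?_
  have h : (fun x : Fin (n + 1) → ℝ => lastRank x) ⁻¹' {i} =
      (fun x : Fin (n + 1) → ℝ =>
        (Finset.univ.filter fun k => x k ≤ x (Fin.last n)).card) ⁻¹' {c | c - 1 = (i : ℕ)} := by
    ext x
    simp [lastRank, Fin.ext_iff]
  rw [h]
  exact hcard (MeasurableSet.of_discrete)

theorem measurable_pathOfSeq {A : Type*} [MeasurableSpace A] :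
    Measurable (pathOfSeq : (ℕ → A × ℝ) → PathSpace A) := by
  refine measurable_pi_lambda _ fun n => Measurable.prodMk ?_ ?_
  · have h : Measurable (fun z : ℕ → A × ℝ =>
        ((fun k : Fin (n + 1) => (z k).1, fun k : Fin (n + 1) => (z k).2) :
          (Fin (n + 1) → A) × (Fin (n + 1) → ℝ))) := by fun_prop
    exact (measurable_inducedOrderStat (n + 1)).comp h
  · have h : Measurable (fun z : ℕ → A × ℝ => fun k : Fin (n + 1) => (z k).2) := by fun_prop
    exact (measurable_lastRank n).comp h

/-- `GL(ρ)`: the law of the path built from an i.i.d. sequence with marginal `ρ`. -/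
def gewpLaw {A : Type*} [MeasurableSpace A] (ρ : ProbabilityMeasure (A × ℝ)) :
    ProbabilityMeasure (PathSpace A) :=
  ⟨(Measure.infinitePi fun _ : ℕ => (ρ : Measure (A × ℝ))).map pathOfSeq,
    Measure.isProbabilityMeasure_map measurable_pathOfSeq.aemeasurable⟩

/-- `κ` is a regular conditional distribution of `X` given the sub-`σ`-field `m`. -/
def IsCondLaw {Ω S : Type*} [MeasurableSpace S] (m : MeasurableSpace Ω) {mΩ : MeasurableSpace Ω}
    (μ : @Measure Ω mΩ) (X : Ω → S) (κ : Ω → ProbabilityMeasure S) : Prop :=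
  Measurable[m] κ ∧ ∀ B : Set S, MeasurableSet B →
    (fun ω => ((κ ω : Measure S) B).toReal) =ᵐ[μ] μ[(X ⁻¹' B).indicator (fun _ => (1 : ℝ)) | m]

/-- `Ξ` is a random directing measure of `(W, η)`: a `C(A)`-valued random variable such that
`Law(W, η | Ξ) = GL(Ξ)` almost surely. -/
def IsDirectingMeasure {Ω A : Type*} [MeasurableSpace Ω] [MeasurableSpace A] (μ : Measure Ω)
    (W : (n : ℕ) → Ω → Fin (n + 1) → A) (η : (n : ℕ) → Ω → Fin (n + 1))
    (Ξ : Ω → uniformMarginal A) : Prop :=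
  Measurable Ξ ∧
    IsCondLaw (MeasurableSpace.comap Ξ inferInstance) μ (path W η)
      (fun ω => gewpLaw (Ξ ω : ProbabilityMeasure (A × ℝ)))

/-- `ρ_w = (1/n) ∑_{j ≤ n} δ_{(w_j, j/n)}` for a word `w` of length `n` (here `n + 1`). -/
def wordMeasure {A : Type*} [MeasurableSpace A] {n : ℕ} (w : Fin (n + 1) → A) :
    ProbabilityMeasure (A × ℝ) :=
  ⟨((n + 1 : ℕ) : ENNReal)⁻¹ •
      ∑ j : Fin (n + 1), Measure.dirac (w j, ((j : ℕ) + 1 : ℝ) / ((n : ℝ) + 1)), ⟨by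
    simp only [Measure.smul_apply, Measure.coe_finsetSum, Finset.sum_apply, measure_univ,
      Finset.sum_const, Finset.card_univ, Fintype.card_fin, smul_eq_mul, nsmul_eq_mul, mul_one]
    exact ENNReal.inv_mul_cancel (by simp) (ENNReal.natCast_ne_top _)⟩⟩

end ErasedWord

end

/-! Read forward in time, erasing becomes insertion: the eraser at time `n + 1` is the place where a
new item, carrying one letter, enters the word of time `n`. Item `k` keeps its letter `Y k`, and its
relative position in the word of time `n` has a limit `U k` almost surely. The directing measure of
the pairs `(Y k, U k)` is the required `Ξ`.

Exchangeability: the positions at time `n` of the items present form a permutation that is uniform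
and independent of the backward field (`IsGEWP.measure_posPerm_inter`). With the permutation held
fixed, the items are functions of the backward field, and exchanging two of them multiplies the
permutation by a transposition. Hence the items are exchangeable (`IsGEWP.exchangeable_itemSeq`).

Recovery: uniformity of all these permutations forces the erasers to be distributed as the relative
ranks of i.i.d. uniform variables. So the `U k` are i.i.d. uniform with the erasers as relative
ranks (`map_limPosSeq_eq`), and sorting the letters by `U` returns the words
(`IsGEWP.ae_pathOfSeq_itemSeq`). De Finetti's theorem (`Exchangeable.exists_directing`) makes the
items conditionally i.i.d.; applying `pathOfSeq` turns this into the mixture of the laws `GL`.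

Convergence and uniqueness: under `GL(ρ)` the word measures converge to `ρ`, by the law of large
numbers and a comparison of sorted positions with the grid `j / n`. This transfers to every
directing measure (`IsDirectingMeasure.ae_tendsto`), so any two are almost surely limits of the same
sequence. -/

noncomputable section

namespace ErasedWord

/-! ### Exchangeable sequences and limits of empirical frequencies -/

section DeFinetti

variable {E : Type*}

/-- The sequence `z` with the entries at `i` and `j` exchanged. -/
def swapSeq (i j : ℕ) (z : ℕ → E) : ℕ → E := fun k => z (Equiv.swap i j k)

theorem swapSeq_swapSeq (i j : ℕ) (z : ℕ → E) : swapSeq i j (swapSeq i j z) = z := by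
  funext k; simp [swapSeq]

/-- Indicator of `B` as a real function. -/
def ind (B : Set E) (x : E) : ℝ := B.indicator (fun _ => (1 : ℝ)) x

theorem ind_nonneg (B : Set E) (x : E) : 0 ≤ ind B x :=
  Set.indicator_nonneg (fun _ _ => zero_le_one) x

theorem ind_le_one (B : Set E) (x : E) : ind B x ≤ 1 :=
  Set.indicator_le' (fun _ _ => le_rfl) (fun _ _ => zero_le_one) x

theorem abs_ind_le (B : Set E) (x : E) : |ind B x| ≤ 1 := by
  rw [abs_of_nonneg (ind_nonneg B x)]; exact ind_le_one B x

theorem ind_mul_self (B : Set E) (x : E) : ind B x * ind B x = ind B x := by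
  by_cases h : x ∈ B <;> simp [ind, h]

/-- The relative frequency of visits to `B` among the first `n` entries. -/
def freq (B : Set E) (n : ℕ) (z : ℕ → E) : ℝ := (∑ k ∈ Finset.range n, ind B (z k)) / n

theorem freq_nonneg (B : Set E) (n : ℕ) (z : ℕ → E) : 0 ≤ freq B n z :=
  div_nonneg (Finset.sum_nonneg fun _ _ => ind_nonneg _ _) (Nat.cast_nonneg n)

theorem freq_le_one (B : Set E) (n : ℕ) (z : ℕ → E) : freq B n z ≤ 1 := by
  refine div_le_one_of_le₀ ?_ (Nat.cast_nonneg n)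
  simpa using Finset.sum_le_card_nsmul (Finset.range n) _ 1 fun k _ => ind_le_one B (z k)

/-- The limit of the relative frequencies along the powers of `4`. -/
def limFreq (B : Set E) (z : ℕ → E) : ℝ := limsup (fun j : ℕ => freq B (4 ^ j) z) atTop

theorem freq_swapSeq (B : Set E) {n i j : ℕ} (hi : i < n) (hj : j < n) (z : ℕ → E) :
    freq B n (swapSeq i j z) = freq B n z := by
  unfold freq swapSeq
  congr 1
  refine Finset.sum_equiv (Equiv.swap i j) (fun k => ?_) (fun k _ => rfl)
  simp only [Finset.mem_range]
  rcases eq_or_ne k i with rfl | hki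
  · simp [hi, hj]
  rcases eq_or_ne k j with rfl | hkj
  · simp [hi, hj]
  rw [Equiv.swap_apply_of_ne_of_ne hki hkj]

variable [MeasurableSpace E]

@[fun_prop]
theorem measurable_swapSeq (i j : ℕ) : Measurable (swapSeq i j : (ℕ → E) → ℕ → E) := by
  unfold swapSeq; fun_prop

/-- A law on sequences is exchangeable if it is invariant under all transpositions. -/
def Exchangeable (P : Measure (ℕ → E)) : Prop := ∀ i j, P.map (swapSeq i j) = P

/-- The `σ`-field of measurable sets of sequences that are invariant under transpositions. -/
abbrev permField (E : Type*) [MeasurableSpace E] : MeasurableSpace (ℕ → E) where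
  MeasurableSet' S := MeasurableSet S ∧ ∀ i j, swapSeq i j ⁻¹' S = S
  measurableSet_empty := ⟨MeasurableSet.empty, fun _ _ => rfl⟩
  measurableSet_compl S h := ⟨h.1.compl, fun i j => by rw [Set.preimage_compl, h.2 i j]⟩
  measurableSet_iUnion f h := ⟨MeasurableSet.iUnion fun n => (h n).1, fun i j => by
    rw [Set.preimage_iUnion]; exact Set.iUnion_congr fun n => (h n).2 i j⟩

theorem permField_le : permField E ≤ MeasurableSpace.pi := fun _ h => h.1

theorem comp_swapSeq_of_measurable_permField {β : Type*} [MeasurableSpace β]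
    [MeasurableSingletonClass β] {F : (ℕ → E) → β} (hF : Measurable[permField E] F) (i j : ℕ)
    (z : ℕ → E) : F (swapSeq i j z) = F z := by
  have h := (hF (measurableSet_singleton (F z))).2 i j
  have : z ∈ swapSeq i j ⁻¹' (F ⁻¹' {F z}) := by rw [h]; rfl
  exact this

theorem measurable_permField {β : Type*} [MeasurableSpace β] {F : (ℕ → E) → β}
    (hF : Measurable F) (h : ∀ i j z, F (swapSeq i j z) = F z) : Measurable[permField E] F :=
  fun S hS => ⟨hF hS, fun i j => by ext z; simp [h i j z]⟩

theorem measurable_ind {B : Set E} (hB : MeasurableSet B) : Measurable (ind B) :=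
  measurable_const.indicator hB

@[fun_prop]
theorem measurable_freq {B : Set E} (hB : MeasurableSet B) (n : ℕ) : Measurable (freq B n) := by
  unfold freq
  exact (Finset.measurable_sum _ fun k _ =>
    (measurable_ind hB).comp (measurable_pi_apply k)).div_const _

theorem measurable_limFreq {B : Set E} (hB : MeasurableSet B) : Measurable (limFreq B) :=
  Measurable.limsup fun j => measurable_freq hB (4 ^ j)

theorem measurable_limFreq_permField {B : Set E} (hB : MeasurableSet B) :
    Measurable[permField E] (limFreq B) := by
  refine measurable_permField (measurable_limFreq hB) fun i j z => ?_
  refine limsup_congr ?_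
  have h4 : Tendsto (fun j : ℕ => 4 ^ j) atTop (atTop : Filter ℕ) :=
    tendsto_pow_atTop_atTop_of_one_lt (by norm_num)
  filter_upwards [h4.eventually_gt_atTop (max i j)] with n hn
  exact freq_swapSeq B ((le_max_left _ _).trans_lt hn) ((le_max_right _ _).trans_lt hn) z

variable {P : Measure (ℕ → E)}

theorem Exchangeable.integral_swapSeq (hP : Exchangeable P) (i j : ℕ) {F : (ℕ → E) → ℝ}
    (hF : Measurable F) : ∫ z, F (swapSeq i j z) ∂P = ∫ z, F z ∂P := by
  conv_rhs => rw [← hP i j]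
  rw [integral_map (measurable_swapSeq i j).aemeasurable hF.aestronglyMeasurable]

theorem Exchangeable.integral_ind (hP : Exchangeable P) {B : Set E} (hB : MeasurableSet B)
    (k : ℕ) : ∫ z, ind B (z k) ∂P = ∫ z, ind B (z 0) ∂P := by
  have h := hP.integral_swapSeq 0 k ((measurable_ind hB).comp (measurable_pi_apply k))
  simpa [swapSeq] using h.symm

theorem Exchangeable.integral_ind_mul_ind (hP : Exchangeable P) {B : Set E}
    (hB : MeasurableSet B) {k l : ℕ} (hkl : k ≠ l) :
    ∫ z, ind B (z k) * ind B (z l) ∂P = ∫ z, ind B (z 0) * ind B (z 1) ∂P := by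
  have hm : ∀ k l : ℕ, Measurable fun z : ℕ → E => ind B (z k) * ind B (z l) := fun k l =>
    ((measurable_ind hB).comp (measurable_pi_apply k)).mul
      ((measurable_ind hB).comp (measurable_pi_apply l))
  have h1 : ∀ l : ℕ, l ≠ 0 →
      ∫ z, ind B (z 0) * ind B (z l) ∂P = ∫ z, ind B (z 0) * ind B (z 1) ∂P := by
    intro l hl
    have h := hP.integral_swapSeq l 1 (hm 0 l)
    rw [← h]
    simp [swapSeq, Equiv.swap_apply_of_ne_of_ne hl.symm zero_ne_one]
  have h2 := hP.integral_swapSeq k 0 (hm k l)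
  rw [← h2]
  simp only [swapSeq, Equiv.swap_apply_left]
  refine h1 _ fun h => hkl ?_
  simpa using (Equiv.swap_apply_eq_iff.1 h).symm

variable [IsProbabilityMeasure P]

theorem integrable_of_bounded {Ω : Type*} [MeasurableSpace Ω] {μ : Measure Ω} [IsFiniteMeasure μ]
    {F : Ω → ℝ} (hF : Measurable F) {C : ℝ} (h : ∀ ω, |F ω| ≤ C) : Integrable F μ :=
  Integrable.of_bound hF.aestronglyMeasurable C (Eventually.of_forall h)

/-- By exchangeability all off-diagonal products have one common mean and all diagonal products
another. The form is chosen so that weights of total mass zero leave only the sum of squares. -/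
theorem Exchangeable.integral_sq_sum (hP : Exchangeable P) {B : Set E} (hB : MeasurableSet B)
    (m : ℕ) (a : ℕ → ℝ) :
    ∫ z, (∑ k ∈ Finset.range m, a k * ind B (z k)) ^ 2 ∂P =
      (∫ z, ind B (z 0) * ind B (z 1) ∂P) * (∑ k ∈ Finset.range m, a k) ^ 2 +
      ((∫ z, ind B (z 0) ∂P) - ∫ z, ind B (z 0) * ind B (z 1) ∂P) *
        ∑ k ∈ Finset.range m, a k ^ 2 := by
  set c := ∫ z, ind B (z 0) * ind B (z 1) ∂P with hc
  set v := ∫ z, ind B (z 0) ∂P with hv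
  have hm : ∀ k l : ℕ, Integrable (fun z : ℕ → E => ind B (z k) * ind B (z l)) P := fun k l =>
    integrable_of_bounded (((measurable_ind hB).comp (measurable_pi_apply k)).mul
      ((measurable_ind hB).comp (measurable_pi_apply l))) (C := 1) fun z => by
        rw [abs_mul]
        exact mul_le_one₀ (abs_ind_le _ _) (abs_nonneg _) (abs_ind_le _ _)
  have hkl : ∀ k l : ℕ, ∫ z, ind B (z k) * ind B (z l) ∂P = c + if k = l then v - c else 0 := by
    intro k l
    split_ifs with h
    · subst h
      simp_rw [ind_mul_self]
      rw [hP.integral_ind hB]; ring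
    · rw [hP.integral_ind_mul_ind hB h]; ring
  calc ∫ z, (∑ k ∈ Finset.range m, a k * ind B (z k)) ^ 2 ∂P
      = ∫ z, ∑ k ∈ Finset.range m, ∑ l ∈ Finset.range m,
          a k * a l * (ind B (z k) * ind B (z l)) ∂P := by
        congr 1; funext z
        rw [sq, Finset.sum_mul_sum]
        refine Finset.sum_congr rfl fun k _ => Finset.sum_congr rfl fun l _ => by ring
    _ = ∑ k ∈ Finset.range m, ∑ l ∈ Finset.range m,
          a k * a l * (c + if k = l then v - c else 0) := by
        rw [integral_finsetSum _ fun k _ => integrable_finsetSum _ fun l _ => (hm k l).const_mul _]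
        refine Finset.sum_congr rfl fun k _ => ?_
        rw [integral_finsetSum _ fun l _ => (hm k l).const_mul _]
        refine Finset.sum_congr rfl fun l _ => ?_
        rw [integral_const_mul, hkl]
    _ = _ := by
        simp_rw [mul_add, Finset.sum_add_distrib, mul_ite, mul_zero, Finset.sum_ite_eq]
        rw [sq, Finset.sum_mul_sum, Finset.mul_sum, Finset.mul_sum]
        congr 1
        · refine Finset.sum_congr rfl fun k _ => ?_
          rw [Finset.mul_sum]
          exact Finset.sum_congr rfl fun l _ => by ring
        · refine Finset.sum_congr rfl fun k hk => ?_
          rw [if_pos hk]; ring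

/-- The difference of two frequencies is a weighted sum of indicators with total weight zero and sum
of squared weights `1 / n - 1 / m`. -/
theorem Exchangeable.integral_sq_freq_sub_le (hP : Exchangeable P) {B : Set E}
    (hB : MeasurableSet B) {n m : ℕ} (hn : 0 < n) (hnm : n ≤ m) :
    ∫ z, (freq B n z - freq B m z) ^ 2 ∂P ≤ 1 / n := by
  have hn' : (n : ℝ) ≠ 0 := by positivity
  have hm' : (m : ℝ) ≠ 0 := by have : 0 < m := hn.trans_le hnm; positivity
  set a : ℕ → ℝ := fun k => (if k < n then (1 / n : ℝ) else 0) - 1 / m with ha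
  have hfil : (Finset.range m).filter (fun k => k < n) = Finset.range n := by
    ext k; simp only [Finset.mem_filter, Finset.mem_range]; omega
  have hsum : ∀ f : ℕ → ℝ, ∑ k ∈ Finset.range m, (if k < n then f k else 0) =
      ∑ k ∈ Finset.range n, f k := fun f => by
    rw [← Finset.sum_filter, hfil]
  have h1 : ∀ z : ℕ → E, freq B n z - freq B m z =
      ∑ k ∈ Finset.range m, a k * ind B (z k) := by
    intro z
    simp only [ha, sub_mul, Finset.sum_sub_distrib, ite_mul, zero_mul, freq]
    rw [hsum, ← Finset.mul_sum, ← Finset.mul_sum]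
    ring
  have h2 : ∑ k ∈ Finset.range m, a k = 0 := by
    simp only [ha, Finset.sum_sub_distrib]
    rw [hsum]
    simp [hn', hm']
  have h3 : ∑ k ∈ Finset.range m, a k ^ 2 ≤ 1 / n := by
    have : ∀ k, a k ^ 2 = (if k < n then ((1 / n : ℝ) ^ 2 - 2 * (1 / n) * (1 / m)) else 0)
        + (1 / m : ℝ) ^ 2 := by
      intro k; simp only [ha]; split_ifs <;> ring
    simp_rw [this, Finset.sum_add_distrib]
    rw [hsum]
    simp only [Finset.sum_const, Finset.card_range, nsmul_eq_mul]
    have : (n : ℝ) * ((1 / n) ^ 2 - 2 * (1 / n) * (1 / m)) + m * (1 / m) ^ 2 = 1 / n - 1 / m := by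
      field_simp; ring
    rw [this]
    have : (0 : ℝ) ≤ 1 / m := by positivity
    linarith
  simp_rw [h1]
  rw [hP.integral_sq_sum hB, h2]
  have hb : ∀ z : ℕ → E, 0 ≤ ind B (z 0) * ind B (z 1) := fun z =>
    mul_nonneg (ind_nonneg _ _) (ind_nonneg _ _)
  have hc0 : 0 ≤ ∫ z, ind B (z 0) * ind B (z 1) ∂P := integral_nonneg hb
  have hv1 : ∫ z, ind B (z 0) ∂P ≤ 1 := by
    have := integral_mono (μ := P) (integrable_of_bounded
      ((measurable_ind hB).comp (measurable_pi_apply 0)) fun z => abs_ind_le B (z 0))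
      (integrable_const (1 : ℝ)) fun z => ind_le_one B (z 0)
    simpa using this
  have hs : 0 ≤ ∑ k ∈ Finset.range m, a k ^ 2 := Finset.sum_nonneg fun k _ => sq_nonneg _
  calc _ ≤ 1 * ∑ k ∈ Finset.range m, a k ^ 2 := by
        simp only [ne_eq, OfNat.ofNat_ne_zero, not_false_eq_true, zero_pow, mul_zero, zero_add]
        exact mul_le_mul_of_nonneg_right (by linarith) hs
    _ ≤ _ := by rw [one_mul]; exact h3

/-- Along the powers of `4` the variance bound gives `L²` distances at most `2⁻ⁿ`, which are
summable; this yields almost sure convergence without a maximal inequality or martingales. -/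
theorem Exchangeable.ae_tendsto_freq (hP : Exchangeable P) {B : Set E} (hB : MeasurableSet B) :
    ∀ᵐ z ∂P, Tendsto (fun j : ℕ => freq B (4 ^ j) z) atTop (𝓝 (limFreq B z)) := by
  have key : ∀ᵐ z ∂P, ∃ l : ℝ, Tendsto (fun j : ℕ => freq B (4 ^ j) z) atTop (𝓝 l) := by
    have h12 : ∀ n m : ℕ, n ≤ m →
        eLpNorm (fun z => freq B (4 ^ n) z - freq B (4 ^ m) z) 2 P ≤
          ENNReal.ofReal ((1 / 2) ^ n) := by
      intro n m hnm
      have hmeas : Measurable fun z : ℕ → E => freq B (4 ^ n) z - freq B (4 ^ m) z :=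
        (measurable_freq hB _).sub (measurable_freq hB _)
      have hLp : MemLp (fun z : ℕ → E => freq B (4 ^ n) z - freq B (4 ^ m) z) 2 P := by
        refine MemLp.of_bound hmeas.aestronglyMeasurable 1 (Eventually.of_forall fun z => ?_)
        have h1 := freq_nonneg B (4 ^ n) z
        have h2 := freq_nonneg B (4 ^ m) z
        have h3 := freq_le_one B (4 ^ n) z
        have h4 := freq_le_one B (4 ^ m) z
        rw [Real.norm_eq_abs, abs_le]; constructor <;> linarith
      rw [hLp.eLpNorm_eq_integral_rpow_norm (by norm_num) (by norm_num)]
      refine ENNReal.ofReal_le_ofReal ?_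
      have h := hP.integral_sq_freq_sub_le hB (n := 4 ^ n) (m := 4 ^ m) (by positivity)
        (Nat.pow_le_pow_right (by norm_num) hnm)
      have h5 : ∫ z, ‖freq B (4 ^ n) z - freq B (4 ^ m) z‖ ^ (2 : ENNReal).toReal ∂P ≤
          ((1 / 2) ^ n) ^ 2 := by
        have e : ((1 / 2 : ℝ) ^ n) ^ 2 = 1 / ((4 ^ n : ℕ) : ℝ) := by
          rw [← pow_mul, mul_comm, pow_mul, one_div, inv_pow, inv_pow]; norm_num
        rw [e]
        simpa using h
      calc _ ≤ (((1 / 2 : ℝ) ^ n) ^ 2) ^ ((2 : ENNReal).toReal⁻¹) :=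
            Real.rpow_le_rpow (integral_nonneg fun z => by positivity) h5 (by simp)
        _ = (1 / 2) ^ n := by
            rw [ENNReal.toReal_ofNat]
            exact Real.pow_rpow_inv_natCast (by positivity) (by norm_num)
    -- The factor `2` in the bound only serves to make the Cauchy inequality strict.
    refine Lp.ae_tendsto_of_cauchy_eLpNorm (p := 2) (f := fun j => freq B (4 ^ j))
      (B := fun N => ENNReal.ofReal (2 * (1 / 2) ^ N))
      (fun j => (measurable_freq hB _).aestronglyMeasurable) (by norm_num) ?_ ?_
    · rw [← ENNReal.ofReal_tsum_of_nonneg (fun n => by positivity)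
        ((summable_geometric_of_lt_one (by norm_num) (by norm_num)).mul_left 2)]
      exact ENNReal.ofReal_ne_top
    · have hlt : ∀ N n m : ℕ, N ≤ n → n ≤ m →
          eLpNorm (fun z => freq B (4 ^ n) z - freq B (4 ^ m) z) 2 P <
            ENNReal.ofReal (2 * (1 / 2) ^ N) := by
        intro N n m hn hm
        refine (h12 n m hm).trans_lt ?_
        rw [ENNReal.ofReal_lt_ofReal_iff (by positivity)]
        have : (1 / 2 : ℝ) ^ n ≤ (1 / 2) ^ N :=
          pow_le_pow_of_le_one (by norm_num) (by norm_num) hn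
        have : (0 : ℝ) < (1 / 2) ^ N := by positivity
        linarith
      intro N n m hn hm
      rcases le_total n m with h | h
      · exact hlt N n m hn h
      · rw [eLpNorm_sub_comm]
        exact hlt N m n hm h
  filter_upwards [key] with z ⟨l, hl⟩
  rwa [limFreq, hl.limsup_eq]

/-- Conditioning on the past and on the invariant events, the next entry is distributed
according to the limiting frequencies. -/
theorem Exchangeable.integral_mul_ind (hP : Exchangeable P) {B : Set E} (hB : MeasurableSet B)
    {F : (ℕ → E) → ℝ} (hF : Measurable F) (hF1 : ∀ z, |F z| ≤ 1) {m : ℕ}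
    (hinv : ∀ k, m < k → ∀ z, F (swapSeq m k z) = F z) :
    ∫ z, F z * ind B (z m) ∂P = ∫ z, F z * limFreq B z ∂P := by
  have hmeas : ∀ k : ℕ, Measurable fun z : ℕ → E => F z * ind B (z k) := fun k =>
    hF.mul ((measurable_ind hB).comp (measurable_pi_apply k))
  have hbd : ∀ (k : ℕ) (z : ℕ → E), |F z * ind B (z k)| ≤ 1 := fun k z => by
    rw [abs_mul]
    exact mul_le_one₀ (hF1 z) (abs_nonneg _) (abs_ind_le _ _)
  have hint : ∀ k : ℕ, Integrable (fun z : ℕ → E => F z * ind B (z k)) P := fun k =>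
    integrable_of_bounded (hmeas k) (hbd k)
  set a : ℕ → ℝ := fun k => ∫ z, F z * ind B (z k) ∂P with ha
  -- Exchanging `m` and `k` fixes `F` and moves entry `k` to place `m`.
  have hak : ∀ k, m ≤ k → a k = a m := by
    intro k hk
    rcases hk.eq_or_lt with rfl | hk
    · rfl
    have h := hP.integral_swapSeq m k (hmeas k)
    rw [ha]
    simp only
    rw [← h]
    simp [swapSeq, hinv k hk]
  have h4 : Tendsto (fun j : ℕ => 4 ^ j) atTop (atTop : Filter ℕ) :=
    tendsto_pow_atTop_atTop_of_one_lt (by norm_num)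
  -- Only the first `m` terms can differ from `a m`, so they vanish in the Cesàro limit. The same
  -- averages are the integrals of `F` against the frequencies, whose limit is found by dominated
  -- convergence.
  have hces : Tendsto (fun n : ℕ => (n : ℝ)⁻¹ * ∑ k ∈ Finset.range n, a k) atTop (𝓝 (a m)) := by
    refine Filter.Tendsto.cesaro ?_
    refine tendsto_const_nhds.congr' ?_
    filter_upwards [eventually_ge_atTop m] with k hk using (hak k hk).symm
  have hfreq : ∀ n : ℕ, ∫ z, F z * freq B n z ∂P = (n : ℝ)⁻¹ * ∑ k ∈ Finset.range n, a k := by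
    intro n
    have : ∀ z : ℕ → E, F z * freq B n z =
        (n : ℝ)⁻¹ * ∑ k ∈ Finset.range n, F z * ind B (z k) := by
      intro z; rw [freq, ← Finset.mul_sum]; ring
    simp_rw [this]
    rw [integral_const_mul, integral_finsetSum _ fun k _ => hint k]
  have hlim : Tendsto (fun j : ℕ => ∫ z, F z * freq B (4 ^ j) z ∂P) atTop
      (𝓝 (∫ z, F z * limFreq B z ∂P)) := by
    refine tendsto_integral_of_dominated_convergence (fun _ => (1 : ℝ))
      (fun j => (hF.mul (measurable_freq hB _)).aestronglyMeasurable) (integrable_const _)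
      (fun j => Eventually.of_forall fun z => ?_) ?_
    · rw [Real.norm_eq_abs, abs_mul, abs_of_nonneg (freq_nonneg _ _ _)]
      exact mul_le_one₀ (hF1 z) (freq_nonneg _ _ _) (freq_le_one _ _ _)
    · filter_upwards [hP.ae_tendsto_freq hB] with z hz using hz.const_mul _
  refine tendsto_nhds_unique ?_ hlim
  simp_rw [hfreq]
  exact hces.comp h4

end DeFinetti

/-! ### De Finetti's theorem -/

section Directing

variable {E : Type*} [MeasurableSpace E]

/-- The law of an i.i.d. sequence with marginal `ρ`. -/
abbrev iidLaw (ρ : ProbabilityMeasure E) : Measure (ℕ → E) :=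
  Measure.infinitePi fun _ : ℕ => (ρ : Measure E)

theorem measurable_iidLaw : Measurable (iidLaw : ProbabilityMeasure E → Measure (ℕ → E)) := by
  refine Measurable.measure_of_isPiSystem_of_isProbabilityMeasure
    generateFrom_squareCylinders.symm
    (isPiSystem_squareCylinders (fun _ => MeasurableSpace.isPiSystem_measurableSet)
      fun _ => MeasurableSet.univ) ?_
  rintro _ ⟨s, t, ht, rfl⟩
  have ht' : ∀ i, MeasurableSet (t i) := fun i => ht i (Set.mem_univ i)
  simp_rw [iidLaw, Measure.infinitePi_pi _ fun i _ => ht' i]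
  exact Finset.measurable_fun_prod _ fun i _ =>
    (Measure.measurable_coe (ht' i)).comp measurable_subtype_coe

theorem measurable_toReal_apply {B : Set E} (hB : MeasurableSet B) :
    Measurable fun ρ : ProbabilityMeasure E => ((ρ : Measure E) B).toReal :=
  ((Measure.measurable_coe hB).comp measurable_subtype_coe).ennreal_toReal

variable {P : Measure (ℕ → E)} [IsProbabilityMeasure P]

/-- This is `Exchangeable.integral_mul_ind` at `m = 0`, tested on indicators of invariant events. -/
theorem Exchangeable.limFreq_ae_eq_condExp (hP : Exchangeable P) {B : Set E}
    (hB : MeasurableSet B) :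
    limFreq B =ᵐ[P] P[((fun z : ℕ → E => z 0) ⁻¹' B).indicator (fun _ => (1 : ℝ)) |
      permField E] := by
  have hpre : MeasurableSet ((fun z : ℕ → E => z 0) ⁻¹' B) := measurable_pi_apply 0 hB
  have hb : ∀ᵐ z ∂P, ‖limFreq B z‖ ≤ 1 := by
    filter_upwards [hP.ae_tendsto_freq hB] with z hz
    rw [Real.norm_eq_abs, abs_le]
    have h0 := ge_of_tendsto' hz fun j => freq_nonneg B (4 ^ j) z
    have h1 := le_of_tendsto' hz fun j => freq_le_one B (4 ^ j) z
    constructor <;> linarith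
  refine ae_eq_condExp_of_forall_setIntegral_eq permField_le
    ((integrable_const (1 : ℝ)).indicator hpre)
    (fun s _ _ => (Integrable.of_bound
      (measurable_limFreq hB).aestronglyMeasurable 1 hb).integrableOn) ?_
    (measurable_limFreq_permField hB).stronglyMeasurable.aestronglyMeasurable
  intro S hS _
  have h := hP.integral_mul_ind hB (F := S.indicator fun _ => (1 : ℝ)) (m := 0)
    (measurable_const.indicator hS.1) (fun z => abs_ind_le S z) (fun k _ z => by
      have : swapSeq 0 k z ∈ S ↔ z ∈ S := by rw [← Set.mem_preimage, hS.2]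
      by_cases hz : z ∈ S
      · rw [Set.indicator_of_mem hz, Set.indicator_of_mem (this.2 hz)]
      · rw [Set.indicator_of_notMem hz, Set.indicator_of_notMem (this.not.2 hz)])
  rw [← integral_indicator hS.1, ← integral_indicator hS.1]
  have e1 : ∀ z, S.indicator (limFreq B) z = S.indicator (fun _ => (1 : ℝ)) z * limFreq B z := by
    intro z; by_cases hz : z ∈ S <;> simp [hz]
  have e2 : ∀ z, S.indicator (((fun z : ℕ → E => z 0) ⁻¹' B).indicator (fun _ => (1 : ℝ))) z =
      S.indicator (fun _ => (1 : ℝ)) z * ind B (z 0) := by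
    intro z
    by_cases hz : z ∈ S
    · rw [Set.indicator_of_mem hz, Set.indicator_of_mem hz, one_mul]; rfl
    · rw [Set.indicator_of_notMem hz, Set.indicator_of_notMem hz, zero_mul]
  simp_rw [e1, e2]
  exact h.symm

/-- The last coordinate is integrated out first: the earlier factors do not see exchanges of `m`
with later indices. Its replacement `Ξ z (B m)` is invariant and is absorbed into `g`, which is why
the induction runs over all `g`. -/
theorem Exchangeable.integral_mul_prod_ind (hP : Exchangeable P)
    {Ξ : (ℕ → E) → ProbabilityMeasure E} (hΞ : Measurable[permField E] Ξ)
    (hlim : ∀ B : Set E, MeasurableSet B → ∀ᵐ z ∂P, ((Ξ z : Measure E) B).toReal = limFreq B z)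
    {B : ℕ → Set E} (hB : ∀ k, MeasurableSet (B k)) (m : ℕ) {g : (ℕ → E) → ℝ}
    (hg : Measurable[permField E] g) (hg1 : ∀ z, |g z| ≤ 1) :
    ∫ z, g z * ∏ k ∈ Finset.range m, ind (B k) (z k) ∂P =
      ∫ z, g z * ∏ k ∈ Finset.range m, ((Ξ z : Measure E) (B k)).toReal ∂P := by
  induction m generalizing g with
  | zero => simp
  | succ m ih =>
    have hprod : ∀ z : ℕ → E, |∏ k ∈ Finset.range m, ind (B k) (z k)| ≤ 1 := fun z => by
      rw [Finset.abs_prod]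
      exact Finset.prod_le_one (fun k _ => abs_nonneg _) fun k _ => abs_ind_le _ _
    have hΞ1 : ∀ z, |((Ξ z : Measure E) (B m)).toReal| ≤ 1 := fun z => by
      rw [abs_of_nonneg ENNReal.toReal_nonneg]
      exact measureReal_le_one
    have h1 := hP.integral_mul_ind (hB m) (m := m)
      (F := fun z => g z * ∏ k ∈ Finset.range m, ind (B k) (z k))
      ((hg.mono permField_le le_rfl).mul (Finset.measurable_fun_prod _ fun k _ =>
        (measurable_ind (hB k)).comp (measurable_pi_apply k)))
      (fun z => by rw [abs_mul]; exact mul_le_one₀ (hg1 z) (abs_nonneg _) (hprod z))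
      (fun k hk z => by
        rw [comp_swapSeq_of_measurable_permField hg]
        congr 1
        refine Finset.prod_congr rfl fun l hl => ?_
        rw [Finset.mem_range] at hl
        rw [swapSeq, Equiv.swap_apply_of_ne_of_ne (by omega) (by omega)])
    have h2 := ih (g := fun z => g z * ((Ξ z : Measure E) (B m)).toReal)
      (hg.mul ((measurable_toReal_apply (hB m)).comp hΞ))
      (fun z => by rw [abs_mul]; exact mul_le_one₀ (hg1 z) (abs_nonneg _) (hΞ1 z))
    calc _ = ∫ z, (g z * ∏ k ∈ Finset.range m, ind (B k) (z k)) * ind (B m) (z m) ∂P := by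
          simp_rw [Finset.prod_range_succ, mul_assoc]
      _ = ∫ z, (g z * ∏ k ∈ Finset.range m, ind (B k) (z k)) * limFreq (B m) z ∂P := h1
      _ = ∫ z, g z * ((Ξ z : Measure E) (B m)).toReal *
            ∏ k ∈ Finset.range m, ind (B k) (z k) ∂P := by
          refine integral_congr_ae ?_
          filter_upwards [hlim (B m) (hB m)] with z hz
          rw [hz]; ring
      _ = _ := h2
      _ = _ := by
          congr 1; funext z
          rw [Finset.prod_range_succ]; ring

theorem Exchangeable.measure_inter_eq_lintegral (hP : Exchangeable P)
    {Ξ : (ℕ → E) → ProbabilityMeasure E} (hΞ : Measurable[permField E] Ξ)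
    (hlim : ∀ B : Set E, MeasurableSet B → ∀ᵐ z ∂P, ((Ξ z : Measure E) B).toReal = limFreq B z)
    {S : Set (ℕ → E)} (hS : MeasurableSet[permField E] S) {T : Set (ℕ → E)}
    (hT : MeasurableSet T) :
    P (T ∩ S) = ∫⁻ z in S, iidLaw (Ξ z) T ∂P := by
  have hκ : Measurable fun z => iidLaw (Ξ z) :=
    measurable_iidLaw.comp (hΞ.mono permField_le le_rfl)
  -- For fixed `S` both sides are finite measures in `T`, so finite-dimensional rectangles suffice.
  suffices h : P.restrict S = (P.restrict S).bind fun z => iidLaw (Ξ z) by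
    have := congrArg (fun ν => ν T) h
    rwa [Measure.restrict_apply hT, Measure.bind_apply hT hκ.aemeasurable] at this
  refine ext_of_generate_finite _ generateFrom_squareCylinders.symm
    (isPiSystem_squareCylinders (fun _ => MeasurableSpace.isPiSystem_measurableSet)
      fun _ => MeasurableSet.univ) ?_ ?_
  · rintro _ ⟨s, t, ht, rfl⟩
    have ht' : ∀ i, MeasurableSet (t i) := fun i => ht i (Set.mem_univ i)
    have hst : MeasurableSet ((s : Set ℕ).pi t) :=
      MeasurableSet.pi s.countable_toSet fun i _ => ht' i
    rw [Measure.bind_apply hst hκ.aemeasurable]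
    simp_rw [iidLaw, Measure.infinitePi_pi _ fun i _ => ht' i]
    obtain ⟨m, hm⟩ : ∃ m, s ⊆ Finset.range m := s.exists_nat_subset_range
    -- Padding with the whole space turns a product over `s` into one over an initial segment.
    set B : ℕ → Set E := fun k => if k ∈ s then t k else Set.univ with hBdef
    have hB : ∀ k, MeasurableSet (B k) := fun k => by
      simp only [hBdef]; split_ifs
      exacts [ht' k, MeasurableSet.univ]
    have h := hP.integral_mul_prod_ind hΞ hlim hB m (g := S.indicator fun _ => (1 : ℝ))
      (measurable_const.indicator hS) (fun z => abs_ind_le S z)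
    have e1 : ∀ z, S.indicator (fun _ => (1 : ℝ)) z * ∏ k ∈ Finset.range m, ind (B k) (z k) =
        (((s : Set ℕ).pi t) ∩ S).indicator (fun _ => (1 : ℝ)) z := by
      intro z
      have hp : ∏ k ∈ Finset.range m, ind (B k) (z k) =
          ((s : Set ℕ).pi t).indicator (fun _ => (1 : ℝ)) z := by
        by_cases hz : z ∈ (s : Set ℕ).pi t
        · rw [Set.indicator_of_mem hz]
          refine Finset.prod_eq_one fun k _ => ?_
          have : z k ∈ B k := by
            simp only [hBdef]; split_ifs with hk
            exacts [hz k hk, Set.mem_univ _]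
          simp [ind, this]
        · rw [Set.indicator_of_notMem hz]
          simp only [Set.mem_pi, not_forall] at hz
          obtain ⟨k, hk, hkz⟩ := hz
          refine Finset.prod_eq_zero (hm hk) ?_
          have hk' : k ∈ s := hk
          have : z k ∉ B k := by simpa [hBdef, hk'] using hkz
          simp [ind, this]
      rw [hp]
      by_cases h1 : z ∈ S <;> by_cases h2 : z ∈ (s : Set ℕ).pi t <;>
        simp [Set.indicator, h1, h2]
    have e2 : ∀ z, S.indicator (fun _ => (1 : ℝ)) z *
        ∏ k ∈ Finset.range m, ((Ξ z : Measure E) (B k)).toReal =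
        S.indicator (fun z => (∏ k ∈ s, (Ξ z : Measure E) (t k)).toReal) z := by
      intro z
      have hp : ∏ k ∈ Finset.range m, ((Ξ z : Measure E) (B k)).toReal =
          (∏ k ∈ s, (Ξ z : Measure E) (t k)).toReal := by
        rw [ENNReal.toReal_prod, ← Finset.prod_subset hm]
        · exact Finset.prod_congr rfl fun k hk => by simp [hBdef, hk]
        · intro k _ hk; simp [hBdef, hk]
      rw [hp]
      by_cases h1 : z ∈ S <;> simp [Set.indicator, h1]
    simp_rw [e1, e2] at h
    rw [integral_indicator (hst.inter hS.1), integral_indicator hS.1] at h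
    have hmeasp : Measurable fun z => ∏ k ∈ s, (Ξ z : Measure E) (t k) :=
      Finset.measurable_fun_prod _ fun k _ => (Measure.measurable_coe (ht' k)).comp
        (measurable_subtype_coe.comp (hΞ.mono permField_le le_rfl))
    have hle : ∀ z, ∏ k ∈ s, (Ξ z : Measure E) (t k) ≤ 1 := fun z =>
      Finset.prod_le_one' fun k _ => prob_le_one
    rw [integral_toReal hmeasp.aemeasurable
      (Eventually.of_forall fun z => (hle z).trans_lt ENNReal.one_lt_top)] at h
    simp only [integral_const, MeasurableSet.univ, measureReal_restrict_apply, Set.univ_inter,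
      smul_eq_mul, mul_one] at h
    rw [Measure.restrict_apply hst]
    refine (ENNReal.toReal_eq_toReal_iff' (measure_ne_top _ _) ?_).1 h
    refine ((lintegral_mono hle).trans_lt ?_).ne
    simp
  · rw [Measure.bind_apply MeasurableSet.univ hκ.aemeasurable]
    simp

/-- **De Finetti's theorem** -/
theorem Exchangeable.exists_directing [StandardBorelSpace E] (hP : Exchangeable P) :
    ∃ Ξ : (ℕ → E) → ProbabilityMeasure E, Measurable[permField E] Ξ ∧
      (∀ B : Set E, MeasurableSet B →
        ∀ᵐ z ∂P, ((Ξ z : Measure E) B).toReal = limFreq B z) ∧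
      ∀ S, MeasurableSet[permField E] S → ∀ T, MeasurableSet T →
        P (T ∩ S) = ∫⁻ z in S, iidLaw (Ξ z) T ∂P := by
  have h0 : Measurable fun z : ℕ → E => z 0 := measurable_pi_apply 0
  have : Nonempty (ℕ → E) := by
    by_contra h
    rw [not_nonempty_iff] at h
    have := measure_univ (μ := P)
    rw [Measure.eq_zero_of_isEmpty P] at this
    simp at this
  -- The directing measure is the conditional law of the first entry given the invariant field; the
  -- standard Borel hypothesis supplies the kernel.
  let Ξ : (ℕ → E) → ProbabilityMeasure E := fun z =>
    ⟨(condExpKernel P (permField E) z).map fun z => z 0,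
      Measure.isProbabilityMeasure_map h0.aemeasurable⟩
  have hΞ : Measurable[permField E] Ξ :=
    Measurable.subtype_mk ((Measure.measurable_map _ h0).comp
      (condExpKernel P (permField E)).measurable)
  have hlim : ∀ B : Set E, MeasurableSet B →
      ∀ᵐ z ∂P, ((Ξ z : Measure E) B).toReal = limFreq B z := by
    intro B hB
    filter_upwards [hP.limFreq_ae_eq_condExp hB,
      condExpKernel_ae_eq_condExp (μ := P) permField_le (h0 hB)] with z h1 h2
    rw [h1, ← h2]
    simp only [Ξ, ProbabilityMeasure.coe_mk, Measure.map_apply h0 hB]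
    rfl
  exact ⟨Ξ, hΞ, hlim, fun S hS T hT => hP.measure_inter_eq_lintegral hΞ hlim hS hT⟩

end Directing

/-! ### Convergence of the word measures under `GL(ρ)` -/

section Convergence

/-- The uniform distribution on `[0, 1]`. -/
abbrev unif : Measure ℝ := volume.restrict (Set.Icc 0 1)

instance : IsProbabilityMeasure unif := ⟨by simp⟩

theorem unif_Icc {t : ℝ} (ht : t ∈ Set.Icc (0 : ℝ) 1) : unif (Set.Icc 0 t) = ENNReal.ofReal t := by
  rw [Measure.restrict_apply measurableSet_Icc, Set.inter_eq_left.2 (Set.Icc_subset_Icc_right ht.2)]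
  simp

theorem unif_Iic (t : ℝ) : unif (Set.Iic t) = ENNReal.ofReal (min t 1) := by
  have : Set.Iic t ∩ Set.Icc (0 : ℝ) 1 = Set.Icc 0 (min t 1) := by
    ext x; simp only [Set.mem_inter_iff, Set.mem_Iic, Set.mem_Icc, le_min_iff]; tauto
  rw [Measure.restrict_apply measurableSet_Iic, this]
  simp

theorem eq_unif {ν : Measure ℝ} [IsProbabilityMeasure ν]
    (h : ∀ t ∈ Set.Icc (0 : ℝ) 1, ν (Set.Icc 0 t) = ENNReal.ofReal t) : ν = unif := by
  have hsupp : ν (Set.Icc 0 1)ᶜ = 0 := by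
    rw [prob_compl_eq_zero_iff measurableSet_Icc, h 1 (by simp)]; simp
  refine Measure.ext_of_Iic _ _ fun t => ?_
  rw [unif_Iic, ← measure_inter_conull hsupp]
  have : Set.Iic t ∩ Set.Icc (0 : ℝ) 1 = Set.Icc 0 (min t 1) := by
    ext x; simp only [Set.mem_inter_iff, Set.mem_Iic, Set.mem_Icc, le_min_iff]; tauto
  rw [this]
  rcases le_or_gt 0 t with h0 | h0
  · exact h _ ⟨le_min h0 zero_le_one, min_le_right _ _⟩
  · rw [Set.Icc_eq_empty (by simp [h0]), measure_empty, ENNReal.ofReal_of_nonpos]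
    exact (min_le_left _ _).trans h0.le

variable {A : Type*} [MeasurableSpace A]

theorem mem_uniformMarginal_iff {ρ : ProbabilityMeasure (A × ℝ)} :
    ρ ∈ uniformMarginal A ↔ (ρ : Measure (A × ℝ)).map Prod.snd = unif := by
  have e : ∀ t : ℝ, ((ρ : Measure (A × ℝ)).map Prod.snd) (Set.Icc 0 t) =
      (ρ : Measure (A × ℝ)) (Set.univ ×ˢ Set.Icc (0 : ℝ) t) := fun t => by
    rw [Measure.map_apply measurable_snd measurableSet_Icc, Set.univ_prod]
  have : IsProbabilityMeasure ((ρ : Measure (A × ℝ)).map Prod.snd) :=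
    Measure.isProbabilityMeasure_map measurable_snd.aemeasurable
  constructor
  · intro h
    exact eq_unif fun t ht => by rw [e, h t ht]
  · intro h t ht
    rw [← e, h, unif_Icc ht]

theorem toReal_univ_prod_Iic {ρ : ProbabilityMeasure (A × ℝ)} (hρ : ρ ∈ uniformMarginal A)
    (t : ℝ) : ((ρ : Measure (A × ℝ)) (Set.univ ×ˢ Set.Iic t)).toReal = max (min t 1) 0 := by
  rw [Set.univ_prod, ← Measure.map_apply measurable_snd measurableSet_Iic,
    mem_uniformMarginal_iff.1 hρ, unif_Iic, ENNReal.toReal_ofReal']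

theorem ae_tendsto_freq_iidLaw {E : Type*} [MeasurableSpace E] (ρ : ProbabilityMeasure E)
    {D : Set E} (hD : MeasurableSet D) :
    ∀ᵐ z ∂iidLaw ρ, Tendsto (fun n => freq D n z) atTop (𝓝 ((ρ : Measure E) D).toReal) := by
  have hev : ∀ k : ℕ, MeasurePreserving (fun z : ℕ → E => z k) (iidLaw ρ) (ρ : Measure E) :=
    fun k => measurePreserving_eval_infinitePi (fun _ : ℕ => (ρ : Measure E)) k
  have hmeas : ∀ k : ℕ, Measurable fun z : ℕ → E => ind D (z k) := fun k =>
    (measurable_ind hD).comp (measurable_pi_apply k)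
  have hindep : iIndepFun (fun (k : ℕ) (z : ℕ → E) => ind D (z k)) (iidLaw ρ) :=
    iIndepFun_infinitePi (P := fun _ : ℕ => (ρ : Measure E)) (X := fun _ => ind D)
      fun _ => measurable_ind hD
  have hid : ∀ k : ℕ, IdentDistrib (fun z : ℕ → E => ind D (z k)) (fun z => ind D (z 0))
      (iidLaw ρ) (iidLaw ρ) := fun k =>
    ⟨(hmeas k).aemeasurable, (hmeas 0).aemeasurable, by
      rw [show (fun z : ℕ → E => ind D (z k)) = ind D ∘ fun z => z k from rfl,
        show (fun z : ℕ → E => ind D (z 0)) = ind D ∘ fun z => z 0 from rfl,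
        ← Measure.map_map (measurable_ind hD) (measurable_pi_apply k),
        ← Measure.map_map (measurable_ind hD) (measurable_pi_apply 0), (hev k).map_eq,
        (hev 0).map_eq]⟩
  have h := strong_law_ae_real (fun k (z : ℕ → E) => ind D (z k))
    (integrable_of_bounded (hmeas 0) fun z => abs_ind_le D (z 0))
    (fun i j hij => hindep.indepFun hij) hid
  have hint : ∫ z, ind D (z 0) ∂iidLaw ρ = ((ρ : Measure E) D).toReal := by
    rw [← integral_map (μ := iidLaw ρ) (φ := fun z : ℕ → E => z 0) (f := ind D)
      (measurable_pi_apply 0).aemeasurable (measurable_ind hD).aestronglyMeasurable,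
      (hev 0).map_eq]
    simp only [ind]
    rw [integral_indicator hD]
    simp [Measure.real]
  rw [hint] at h
  exact h

theorem wordMeasure_toReal {n : ℕ} (w : Fin (n + 1) → A) {D : Set (A × ℝ)}
    (hD : MeasurableSet D) :
    ((wordMeasure w : Measure (A × ℝ)) D).toReal =
      (∑ j : Fin (n + 1), ind D (w j, ((j : ℕ) + 1 : ℝ) / ((n : ℝ) + 1))) / (n + 1) := by
  simp only [wordMeasure, ProbabilityMeasure.coe_mk, Measure.smul_apply,
    Measure.coe_finsetSum, Finset.sum_apply, smul_eq_mul, ENNReal.toReal_mul,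
    ENNReal.toReal_inv, ENNReal.toReal_natCast]
  rw [ENNReal.toReal_sum fun j _ => measure_ne_top _ _]
  rw [div_eq_inv_mul]
  congr 1
  · push_cast; rfl
  refine Finset.sum_congr rfl fun j _ => ?_
  rw [Measure.dirac_apply' _ hD]
  by_cases h : (w j, ((j : ℕ) + 1 : ℝ) / ((n : ℝ) + 1)) ∈ D <;> simp [ind, h]

/-- The number of grid points not exceeding `t` is `⌊t (n + 1)⌋`, capped at `n + 1`; the `max` with
`0` covers negative `t`. -/
theorem sum_ind_fin_div (n : ℕ) (t : ℝ) :
    (∑ i : Fin (n + 1), ind (Set.Iic t) (((i : ℕ) + 1 : ℝ) / ((n : ℝ) + 1))) / (n + 1) =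
      min ((⌊max t 0 * ((n + 1 : ℕ) : ℝ)⌋₊ : ℝ) / ((n + 1 : ℕ) : ℝ)) 1 := by
  have hpos : (0 : ℝ) < (n : ℝ) + 1 := by positivity
  have h1 : ∀ i : Fin (n + 1), ind (Set.Iic t) (((i : ℕ) + 1 : ℝ) / ((n : ℝ) + 1)) =
      if (i : ℕ) < ⌊max t 0 * ((n + 1 : ℕ) : ℝ)⌋₊ then 1 else 0 := by
    intro i
    have : ((i : ℕ) + 1 : ℝ) / ((n : ℝ) + 1) ∈ Set.Iic t ↔
        (i : ℕ) < ⌊max t 0 * ((n + 1 : ℕ) : ℝ)⌋₊ := by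
      rw [Nat.lt_iff_add_one_le, Nat.le_floor_iff' (by omega), Set.mem_Iic]
      have hq : (0 : ℝ) < ((i : ℕ) + 1 : ℝ) / ((n : ℝ) + 1) := by positivity
      have : ((i : ℕ) + 1 : ℝ) / ((n : ℝ) + 1) ≤ t ↔
          ((i : ℕ) + 1 : ℝ) / ((n : ℝ) + 1) ≤ max t 0 := by
        rw [le_max_iff, or_iff_left (not_le.2 hq)]
      rw [this, div_le_iff₀ hpos]
      push_cast; rfl
    by_cases h : ((i : ℕ) + 1 : ℝ) / ((n : ℝ) + 1) ∈ Set.Iic t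
    · rw [if_pos (this.1 h)]; simp only [ind, Set.indicator_of_mem h]
    · rw [if_neg (this.not.1 h)]; simp only [ind, Set.indicator_of_notMem h]
  simp_rw [h1]
  set F := ⌊max t 0 * ((n + 1 : ℕ) : ℝ)⌋₊
  rw [Fin.sum_univ_eq_sum_range (fun i => if i < F then (1 : ℝ) else 0) (n + 1),
    ← Finset.sum_filter]
  have h2 : (Finset.range (n + 1)).filter (fun i => i < F) = Finset.range (min F (n + 1)) := by
    ext k; simp only [Finset.mem_filter, Finset.mem_range, lt_min_iff]; tauto
  rw [h2]
  simp only [Finset.sum_const, Finset.card_range, nsmul_eq_mul, mul_one, Nat.cast_min]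
  push_cast
  rw [← min_div_div_right hpos.le, div_self hpos.ne']

theorem tendsto_sum_ind_fin_div (t : ℝ) :
    Tendsto (fun n : ℕ => (∑ i : Fin (n + 1),
      ind (Set.Iic t) (((i : ℕ) + 1 : ℝ) / ((n : ℝ) + 1))) / ((n : ℝ) + 1)) atTop
      (𝓝 (max (min t 1) 0)) := by
  simp_rw [sum_ind_fin_div]
  have h := (tendsto_nat_floor_mul_div_atTop (R := ℝ) (le_max_right t 0)).comp
    (tendsto_natCast_atTop_atTop.comp (tendsto_add_atTop_nat 1))
  have h2 := h.min (tendsto_const_nhds (x := (1 : ℝ)))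
  have e : max (min t 1) 0 = min (max t 0) 1 := by
    rw [max_min_distrib_right]; simp
  rw [e]
  exact h2

/-- Counting letters along two initial segments differs at most by the difference of the
lengths of the segments. -/
theorem abs_sum_mul_sub_le {N : ℕ} {p q : Fin N → ℝ} {f : Fin N → ℝ}
    (hf : ∀ i, 0 ≤ f i ∧ f i ≤ 1) (hpq : (∀ i, p i ≤ q i) ∨ ∀ i, q i ≤ p i) :
    |∑ i, f i * p i - ∑ i, f i * q i| ≤ |∑ i, p i - ∑ i, q i| := by
  have key : ∀ {p q : Fin N → ℝ}, (∀ i, p i ≤ q i) →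
      |∑ i, f i * p i - ∑ i, f i * q i| ≤ |∑ i, p i - ∑ i, q i| := by
    intro p q h
    rw [abs_sub_comm, abs_sub_comm (∑ i, p i), ← Finset.sum_sub_distrib,
      ← Finset.sum_sub_distrib]
    have h1 : ∀ i, 0 ≤ f i * q i - f i * p i := fun i => by
      nlinarith [(hf i).1, h i]
    have h2 : ∀ i, f i * q i - f i * p i ≤ q i - p i := fun i => by
      nlinarith [(hf i).2, h i]
    rw [abs_of_nonneg (Finset.sum_nonneg fun i _ => h1 i)]
    exact (Finset.sum_le_sum fun i _ => h2 i).trans (le_abs_self _)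
  rcases hpq with h | h
  · exact key h
  · rw [abs_sub_comm, abs_sub_comm (∑ i, p i)]; exact key h

/-- Both conditions cut out initial segments of indices, and initial segments are nested. -/
theorem ind_le_ind_or {N : ℕ} {a b : Fin N → ℝ} (ha : Monotone a) (hb : Monotone b) (t : ℝ) :
    (∀ i, ind (Set.Iic t) (a i) ≤ ind (Set.Iic t) (b i)) ∨
      ∀ i, ind (Set.Iic t) (b i) ≤ ind (Set.Iic t) (a i) := by
  have hle : ∀ x y : ℝ, (x ≤ t → y ≤ t) → ind (Set.Iic t) x ≤ ind (Set.Iic t) y := by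
    intro x y h
    by_cases hx : x ≤ t
    · simp [ind, hx, h hx]
    · simp only [ind]
      rw [Set.indicator_of_notMem (by simpa using hx)]
      exact Set.indicator_nonneg (fun _ _ => zero_le_one) _
  have hP : IsLowerSet {i | a i ≤ t} := fun i j hij hi => (ha hij).trans hi
  have hQ : IsLowerSet {i | b i ≤ t} := fun i j hij hi => (hb hij).trans hi
  rcases hP.total hQ with h | h
  · exact Or.inl fun i => hle _ _ fun hi => h hi
  · exact Or.inr fun i => hle _ _ fun hi => h hi

/-- After sorting, the word measure and the empirical measure carry the same letters in the same
order; only the heights differ, grid points against order statistics. Both count letters of `B`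
along initial segments, so the error is at most that of the whole alphabet, a bound free of `B`. -/
theorem abs_wordMeasure_pathOfSeq_sub_le (z : ℕ → A × ℝ) (n : ℕ) {B : Set A}
    (hB : MeasurableSet B) (t : ℝ) :
    |((wordMeasure (pathOfSeq z n).1 : Measure (A × ℝ)) (B ×ˢ Set.Iic t)).toReal -
        freq (B ×ˢ Set.Iic t) (n + 1) z| ≤
      |(∑ i : Fin (n + 1), ind (Set.Iic t) (((i : ℕ) + 1 : ℝ) / ((n : ℝ) + 1))) / ((n : ℝ) + 1) -
        freq (Set.univ ×ˢ Set.Iic t) (n + 1) z| := by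
  have hpos : (0 : ℝ) < (n : ℝ) + 1 := by positivity
  set x : Fin (n + 1) → ℝ := fun k => (z k).2 with hx
  set σ := Tuple.sort x with hσ
  have hind : ∀ (B : Set A) (a : A) (s : ℝ),
      ind (B ×ˢ Set.Iic t) (a, s) = ind B a * ind (Set.Iic t) s := by
    intro B a s
    by_cases h1 : a ∈ B <;> by_cases h2 : s ≤ t <;> simp [ind, h1, h2]
  have hfr : ∀ B : Set A, freq (B ×ˢ Set.Iic t) (n + 1) z =
      (∑ i, ind B (z (σ i)).1 * ind (Set.Iic t) (x (σ i))) / ((n : ℝ) + 1) := by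
    intro B
    rw [freq, ← Fin.sum_univ_eq_sum_range (fun k => ind (B ×ˢ Set.Iic t) (z k)) (n + 1),
      ← Equiv.sum_comp σ]
    push_cast
    congr 1
    exact Finset.sum_congr rfl fun i _ => hind B _ _
  rw [wordMeasure_toReal _ (hB.prod measurableSet_Iic), hfr, hfr, div_sub_div_same,
    div_sub_div_same, abs_div, abs_div]
  refine div_le_div_of_nonneg_right ?_ (abs_nonneg _)
  have huniv : ∀ i, ind (Set.univ : Set A) (z (σ i)).1 = 1 := fun i => by simp [ind]
  simp_rw [huniv, one_mul, hind]
  refine abs_sum_mul_sub_le (f := fun i => ind B (z (σ i)).1)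
    (fun i => ⟨ind_nonneg _ _, ind_le_one _ _⟩) (ind_le_ind_or ?_ (Tuple.monotone_sort x) t)
  intro i j hij
  have : ((i : ℕ) : ℝ) ≤ (j : ℕ) := by exact_mod_cast hij
  exact div_le_div_of_nonneg_right (by linarith) hpos.le

theorem ae_tendsto_wordMeasure_pathOfSeq {ρ : ProbabilityMeasure (A × ℝ)}
    (hρ : ρ ∈ uniformMarginal A) {B : Set A} (hB : MeasurableSet B) (t : ℝ) :
    ∀ᵐ z ∂iidLaw ρ, Tendsto (fun n =>
      ((wordMeasure (pathOfSeq z n).1 : Measure (A × ℝ)) (B ×ˢ Set.Iic t)).toReal) atTop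
      (𝓝 ((ρ : Measure (A × ℝ)) (B ×ˢ Set.Iic t)).toReal) := by
  filter_upwards [ae_tendsto_freq_iidLaw ρ (hB.prod (measurableSet_Iic (a := t))),
    ae_tendsto_freq_iidLaw ρ (MeasurableSet.univ.prod (measurableSet_Iic (a := t)))] with z h1 h2
  rw [toReal_univ_prod_Iic hρ] at h2
  have h3 := (tendsto_sum_ind_fin_div t).sub (h2.comp (tendsto_add_atTop_nat 1))
  rw [sub_self] at h3
  have h4 : Tendsto (fun n =>
      ((wordMeasure (pathOfSeq z n).1 : Measure (A × ℝ)) (B ×ˢ Set.Iic t)).toReal -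
        freq (B ×ˢ Set.Iic t) (n + 1) z) atTop (𝓝 0) :=
    squeeze_zero_norm (fun n => abs_wordMeasure_pathOfSeq_sub_le z n hB t)
      (by simpa using h3.abs)
  have h5 := h4.add (h1.comp (tendsto_add_atTop_nat 1))
  simpa using h5

end Convergence

/-! ### Almost sure convergence to any directing measure -/

section Uniqueness

variable {A : Type*}

/-- A countable algebra of sets containing a basis of the topology. -/
def basisAlgebra (A : Type*) [TopologicalSpace A] [SecondCountableTopology A] : Set (Set A) :=
  generateSetAlgebra (TopologicalSpace.countableBasis A)

theorem countable_basisAlgebra [TopologicalSpace A] [SecondCountableTopology A] :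
    (basisAlgebra A).Countable :=
  countable_generateSetAlgebra (TopologicalSpace.countable_countableBasis A)

theorem measurableSet_of_mem_basisAlgebra [TopologicalSpace A] [SecondCountableTopology A]
    [MeasurableSpace A] [OpensMeasurableSpace A] {B : Set A} (hB : B ∈ basisAlgebra A) :
    MeasurableSet B := by
  have h : MeasurableSet[MeasurableSpace.generateFrom (basisAlgebra A)] B :=
    MeasurableSpace.measurableSet_generateFrom hB
  rw [basisAlgebra, generateFrom_generateSetAlgebra_eq] at h
  exact MeasurableSpace.generateFrom_le
    (fun s hs => (TopologicalSpace.isOpen_of_mem_countableBasis hs).measurableSet) B h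

/-- Rectangles `B ×ˢ Ioc q r` with rational ends form a π-system containing small neighbourhoods of
every point, which determines weak convergence. Their masses are differences of the given
quantities, and only countably many conditions are used. -/
theorem tendsto_probabilityMeasure_of_tendsto_prod_Iic [TopologicalSpace A]
    [SecondCountableTopology A] [MeasurableSpace A] [OpensMeasurableSpace A]
    {ν : ℕ → ProbabilityMeasure (A × ℝ)} {ρ : ProbabilityMeasure (A × ℝ)}
    (h : ∀ B ∈ basisAlgebra A, ∀ q : ℚ, Tendsto
      (fun n => ((ν n : Measure (A × ℝ)) (B ×ˢ Set.Iic (q : ℝ))).toReal) atTop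
      (𝓝 ((ρ : Measure (A × ℝ)) (B ×ˢ Set.Iic (q : ℝ))).toReal)) :
    Tendsto ν atTop (𝓝 ρ) := by
  let S : Set (Set (A × ℝ)) :=
    {D | ∃ B ∈ basisAlgebra A, ∃ q r : ℚ, q ≤ r ∧ D = B ×ˢ Set.Ioc (q : ℝ) r}
  have hS : IsPiSystem S := by
    rintro _ ⟨B, hB, q, r, hqr, rfl⟩ _ ⟨B', hB', q', r', hqr', rfl⟩ hne
    refine ⟨B ∩ B', isSetAlgebra_generateSetAlgebra.inter_mem hB hB', q ⊔ q', r ⊓ r', ?_, ?_⟩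
    · obtain ⟨⟨a, x⟩, ⟨-, h1, h2⟩, -, h3, h4⟩ := hne
      have : ((q ⊔ q' : ℚ) : ℝ) ≤ ((r ⊓ r' : ℚ) : ℝ) := by
        push_cast
        exact (max_lt h1 h3).le.trans (le_min h2 h4)
      exact_mod_cast this
    · rw [Set.prod_inter_prod, Set.Ioc_inter_Ioc]
      push_cast; rfl
  refine hS.tendsto_probabilityMeasure_of_tendsto_of_mem ?_ ?_ ?_
  · rintro _ ⟨B, hB, q, r, -, rfl⟩
    exact (measurableSet_of_mem_basisAlgebra hB).prod measurableSet_Ioc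
  · rintro u hu ⟨a, x⟩ hax
    obtain ⟨V, hV, V', hV', hVV⟩ := mem_nhds_prod_iff.1 (hu.mem_nhds hax)
    obtain ⟨B, hB, haB, hBV⟩ :=
      (TopologicalSpace.isBasis_countableBasis A).mem_nhds_iff.1 hV
    obtain ⟨l, r, ⟨hl, hr⟩, hlr⟩ := mem_nhds_iff_exists_Ioo_subset.1 hV'
    obtain ⟨q, hq1, hq2⟩ := exists_rat_btwn hl
    obtain ⟨s, hs1, hs2⟩ := exists_rat_btwn hr
    refine ⟨B ×ˢ Set.Ioc (q : ℝ) s, ⟨B, self_subset_generateSetAlgebra hB, q, s, ?_, rfl⟩, ?_, ?_⟩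
    · exact_mod_cast (hq2.trans hs1).le
    · exact prod_mem_nhds ((TopologicalSpace.isOpen_of_mem_countableBasis hB).mem_nhds haB)
        (Ioc_mem_nhds hq2 hs1)
    · refine (Set.prod_mono hBV ?_).trans hVV
      exact fun y hy => hlr ⟨hq1.trans hy.1, hy.2.trans_lt hs2⟩
  · rintro _ ⟨B, hB, q, r, hqr, rfl⟩
    have hqr' : (q : ℝ) ≤ r := by exact_mod_cast hqr
    have hm := measurableSet_of_mem_basisAlgebra hB
    have e : ∀ τ : ProbabilityMeasure (A × ℝ), ((τ (B ×ˢ Set.Ioc (q : ℝ) r) : NNReal) : ℝ) =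
        ((τ : Measure (A × ℝ)) (B ×ˢ Set.Iic (r : ℝ))).toReal -
          ((τ : Measure (A × ℝ)) (B ×ˢ Set.Iic (q : ℝ))).toReal := by
      intro τ
      have hd : B ×ˢ Set.Ioc (q : ℝ) r = B ×ˢ Set.Iic (r : ℝ) \ B ×ˢ Set.Iic (q : ℝ) := by
        ext ⟨a, x⟩
        simp only [Set.mem_prod, Set.mem_Ioc, Set.mem_sdiff, Set.mem_Iic, not_and, not_le]
        tauto
      rw [hd]
      exact measureReal_sdiff (Set.prod_mono_right (Set.Iic_subset_Iic.2 hqr'))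
        (hm.prod measurableSet_Iic)
    rw [← NNReal.tendsto_coe]
    simp_rw [e]
    exact (h B hB r).sub (h B hB q)

variable [MeasurableSpace A]

theorem measurable_gewpLaw :
    Measurable (gewpLaw : ProbabilityMeasure (A × ℝ) → ProbabilityMeasure (PathSpace A)) :=
  Measurable.subtype_mk ((Measure.measurable_map _ measurable_pathOfSeq).comp measurable_iidLaw)

theorem measurable_wordMeasure_toReal {n : ℕ} {D : Set (A × ℝ)} (hD : MeasurableSet D) :
    Measurable fun w : Fin (n + 1) → A => ((wordMeasure w : Measure (A × ℝ)) D).toReal := by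
  simp_rw [wordMeasure_toReal _ hD]
  refine (Finset.measurable_sum _ fun j _ => (measurable_ind hD).comp ?_).div_const _
  fun_prop

variable {Ω : Type*} [MeasurableSpace Ω] {μ : Measure Ω}
  {W : (n : ℕ) → Ω → Fin (n + 1) → A} {η : (n : ℕ) → Ω → Fin (n + 1)}

theorem IsGEWP.measurable_path (h : IsGEWP μ W η) : Measurable (path W η) :=
  measurable_pi_lambda _ fun n => (h.measurable_word n).prodMk (h.measurable_eraser n)

variable [IsProbabilityMeasure μ]

/-- The conditional law identifies the joint law of `(Ξ, path)` as the law of `Ξ` composed with the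
kernel `GL`, so Fubini transfers statements that hold `GL(ξ)`-almost surely for each fixed `ξ`. -/
theorem IsDirectingMeasure.ae_of_ae_gewpLaw (hW : IsGEWP μ W η) {Ξ : Ω → uniformMarginal A}
    (h : IsDirectingMeasure μ W η Ξ) {p : uniformMarginal A × PathSpace A → Prop}
    (hp : MeasurableSet {x | p x})
    (hae : ∀ ξ : uniformMarginal A,
      ∀ᵐ x ∂(gewpLaw (ξ : ProbabilityMeasure (A × ℝ)) : Measure (PathSpace A)), p (ξ, x)) :
    ∀ᵐ ω ∂μ, p (Ξ ω, path W η ω) := by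
  let κ : Kernel (uniformMarginal A) (PathSpace A) :=
    ⟨fun ξ => (gewpLaw (ξ : ProbabilityMeasure (A × ℝ)) : Measure (PathSpace A)),
      measurable_subtype_coe.comp (measurable_gewpLaw.comp measurable_subtype_coe)⟩
  have : IsMarkovKernel κ := ⟨fun ξ => (gewpLaw (ξ : ProbabilityMeasure (A × ℝ))).2⟩
  have hpath := hW.measurable_path
  have hle : MeasurableSpace.comap Ξ inferInstance ≤ ‹MeasurableSpace Ω› := h.1.comap_le
  have hjoint : μ.map (fun ω => (Ξ ω, path W η ω)) = (μ.map Ξ) ⊗ₘ κ := by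
    have : IsProbabilityMeasure (μ.map fun ω => (Ξ ω, path W η ω)) :=
      Measure.isProbabilityMeasure_map (h.1.prodMk hpath).aemeasurable
    have : IsProbabilityMeasure (μ.map Ξ) :=
      Measure.isProbabilityMeasure_map h.1.aemeasurable
    refine Measure.ext_prod fun {C B} hC hB => ?_
    rw [Measure.map_apply (h.1.prodMk hpath) (hC.prod hB), Measure.compProd_apply_prod hC hB,
      setLIntegral_map hC (κ.measurable_coe hB) h.1]
    have hcond := h.2.2 B hB
    have hS : MeasurableSet[MeasurableSpace.comap Ξ inferInstance] (Ξ ⁻¹' C) := ⟨C, hC, rfl⟩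
    have h1 := setIntegral_condExp (μ := μ) hle
      ((integrable_const (1 : ℝ)).indicator (hpath hB)) hS
    have hκm : Measurable fun ω => κ (Ξ ω) B := (κ.measurable_coe hB).comp h.1
    have hfin : ∀ᵐ ω ∂μ.restrict (Ξ ⁻¹' C), κ (Ξ ω) B < ⊤ :=
      Eventually.of_forall fun ω => measure_lt_top _ _
    rw [← setIntegral_congr_ae (hle _ hS) (hcond.mono fun ω hω _ => hω),
      show ∫ ω in Ξ ⁻¹' C, ((gewpLaw (Ξ ω : ProbabilityMeasure (A × ℝ)) :
        Measure (PathSpace A)) B).toReal ∂μ = ∫ ω in Ξ ⁻¹' C, (κ (Ξ ω) B).toReal ∂μ from rfl,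
      integral_toReal hκm.aemeasurable hfin,
      integral_indicator (hpath hB), Measure.restrict_restrict (hpath hB)] at h1
    simp only [integral_const, MeasurableSet.univ, measureReal_restrict_apply, Set.univ_inter,
      smul_eq_mul, mul_one] at h1
    have h2 := (ENNReal.toReal_eq_toReal_iff' ?_ (measure_ne_top μ _)).1 h1
    · rw [show (fun ω => (Ξ ω, path W η ω)) ⁻¹' C ×ˢ B = path W η ⁻¹' B ∩ Ξ ⁻¹' C by
        ext ω; simp [and_comm]]
      exact h2.symm
    · refine ((lintegral_mono fun ω => prob_le_one).trans_lt
        (?_ : ∫⁻ _ in Ξ ⁻¹' C, 1 ∂μ < ⊤)).ne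
      simp
  have hall : ∀ᵐ x ∂((μ.map Ξ) ⊗ₘ κ), p x :=
    (Measure.ae_compProd_iff hp).2 (Eventually.of_forall hae)
  rw [← hjoint] at hall
  exact (ae_map_iff (h.1.prodMk hpath).aemeasurable hp).1 hall

/-- The limit on a single rectangle is a measurable event of `(Ξ, path)`, to which the transfer
applies; the countable algebra and rational heights give one null set. -/
theorem IsDirectingMeasure.ae_tendsto [TopologicalSpace A] [SecondCountableTopology A]
    [OpensMeasurableSpace A] (hW : IsGEWP μ W η) {Ξ : Ω → uniformMarginal A}
    (h : IsDirectingMeasure μ W η Ξ) :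
    ∀ᵐ ω ∂μ, Tendsto (fun n => wordMeasure (W n ω)) atTop
      (𝓝 (Ξ ω : ProbabilityMeasure (A × ℝ))) := by
  have key : ∀ B ∈ basisAlgebra A, ∀ q : ℚ, ∀ᵐ ω ∂μ, Tendsto
      (fun n => ((wordMeasure (W n ω) : Measure (A × ℝ)) (B ×ˢ Set.Iic (q : ℝ))).toReal) atTop
      (𝓝 (((Ξ ω : ProbabilityMeasure (A × ℝ)) : Measure (A × ℝ))
        (B ×ˢ Set.Iic (q : ℝ))).toReal) := by
    intro B hB q
    have hm := measurableSet_of_mem_basisAlgebra hB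
    have hD : MeasurableSet (B ×ˢ Set.Iic (q : ℝ)) := hm.prod measurableSet_Iic
    let p : uniformMarginal A × PathSpace A → Prop := fun x => Tendsto
      (fun n => ((wordMeasure (x.2 n).1 : Measure (A × ℝ)) (B ×ˢ Set.Iic (q : ℝ))).toReal) atTop
      (𝓝 (((x.1 : ProbabilityMeasure (A × ℝ)) : Measure (A × ℝ))
        (B ×ˢ Set.Iic (q : ℝ))).toReal)
    have hn : ∀ n, Measurable fun x : PathSpace A =>
        ((wordMeasure (x n).1 : Measure (A × ℝ)) (B ×ˢ Set.Iic (q : ℝ))).toReal := fun n =>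
      (measurable_wordMeasure_toReal hD).comp (measurable_fst.comp (measurable_pi_apply n))
    have hp : MeasurableSet {x | p x} :=
      measurableSet_tendsto_fun (fun n => (hn n).comp measurable_snd)
        ((measurable_toReal_apply hD).comp (measurable_subtype_coe.comp measurable_fst))
    refine h.ae_of_ae_gewpLaw hW hp fun ξ => ?_
    simp only [gewpLaw, ProbabilityMeasure.coe_mk]
    have hp' : MeasurableSet {x | p (ξ, x)} := measurable_prodMk_left hp
    rw [ae_map_iff measurable_pathOfSeq.aemeasurable hp']
    exact ae_tendsto_wordMeasure_pathOfSeq ξ.2 hm q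
  have key' : ∀ᵐ ω ∂μ, ∀ B ∈ basisAlgebra A, ∀ q : ℚ, Tendsto
      (fun n => ((wordMeasure (W n ω) : Measure (A × ℝ)) (B ×ˢ Set.Iic (q : ℝ))).toReal) atTop
      (𝓝 (((Ξ ω : ProbabilityMeasure (A × ℝ)) : Measure (A × ℝ))
        (B ×ˢ Set.Iic (q : ℝ))).toReal) := by
    rw [ae_ball_iff countable_basisAlgebra]
    intro B hB
    exact ae_all_iff.2 (key B hB)
  filter_upwards [key'] with ω hω using tendsto_probabilityMeasure_of_tendsto_prod_Iic hω

end Uniqueness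

/-! ### Positions of inserted items, permutations and relative ranks -/

section Positions

/-- Insertion at position `e (n + 1)` at each time `n + 1 > k` moves the item that is at position
`r` at time `k` to the position `track e k r n` at time `n`. -/
def track (e : ℕ → ℕ) (k r : ℕ) : ℕ → ℕ
  | 0 => r
  | n + 1 => if n + 1 ≤ k then r else
      if e (n + 1) ≤ track e k r n then track e k r n + 1 else track e k r n

theorem track_of_le {e : ℕ → ℕ} {k r n : ℕ} (h : n ≤ k) : track e k r n = r := by
  cases n with
  | zero => rfl
  | succ n => simp [track, h]

theorem track_succ {e : ℕ → ℕ} {k r n : ℕ} (h : k ≤ n) :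
    track e k r (n + 1) =
      if e (n + 1) ≤ track e k r n then track e k r n + 1 else track e k r n := by
  rw [track, if_neg (by omega)]

theorem track_track (e : ℕ → ℕ) {k r m n : ℕ} (hkm : k ≤ m) (hmn : m ≤ n) :
    track e m (track e k r m) n = track e k r n := by
  induction n, hmn using Nat.le_induction with
  | base => rw [track_of_le le_rfl]
  | succ n hmn ih => rw [track_succ hmn, track_succ (hkm.trans hmn), ih]

/-- The limiting relative position of the item that is at position `r` at time `k`. -/
def limPos (e : ℕ → ℕ) (k r : ℕ) : ℝ :=
  limsup (fun n : ℕ => (track e k r n : ℝ) / ((n : ℝ) + 1)) atTop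

theorem limPos_track (e : ℕ → ℕ) {k r m : ℕ} (hkm : k ≤ m) :
    limPos e m (track e k r m) = limPos e k r := by
  refine limsup_congr ?_
  filter_upwards [eventually_ge_atTop m] with n hn
  rw [track_track e hkm hn]

/-- Positions at time `n` of the items inserted at the times `0, …, n`. -/
def posn (e : (n : ℕ) → Fin (n + 1)) : (n : ℕ) → Fin (n + 1) → Fin (n + 1)
  | 0 => id
  | n + 1 => Fin.snoc (α := fun _ => Fin (n + 2))
      (fun k => (e (n + 1)).succAbove (posn e n k)) (e (n + 1))

theorem posn_castSucc (e : (n : ℕ) → Fin (n + 1)) (n : ℕ) (k : Fin (n + 1)) :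
    posn e (n + 1) k.castSucc = (e (n + 1)).succAbove (posn e n k) := by
  rw [posn, Fin.snoc_castSucc]

theorem posn_last (e : (n : ℕ) → Fin (n + 1)) (n : ℕ) : posn e n (Fin.last n) = e n := by
  cases n with
  | zero => exact Subsingleton.elim (α := Fin 1) _ _
  | succ n => rw [posn, Fin.snoc_last]

/-- Links the `Fin`-valued recursion to a natural-number one, in which a single item can be followed
through words of varying length. -/
theorem posn_eq_track (e : (n : ℕ) → Fin (n + 1)) (n : ℕ) (k : Fin (n + 1)) :
    (posn e n k : ℕ) = track (fun m => e m) k (e k) n := by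
  induction n with
  | zero =>
    have h1 := (posn e 0 k).isLt
    have h2 := k.isLt
    have h3 := (e k).isLt
    rw [track]; omega
  | succ n ih =>
    refine Fin.lastCases ?_ (fun k => ?_) k
    · rw [posn_last, track_of_le (by simp)]; simp
    · rw [posn_castSucc, Fin.val_castSucc, track_succ (by omega), ← ih, Fin.succAbove]
      by_cases h : (posn e n k).castSucc < e (n + 1)
      · rw [if_pos h, if_neg (by rw [Fin.lt_def] at h; simpa using h)]; simp
      · rw [if_neg h, if_pos (by rw [Fin.lt_def] at h; simpa using h)]; simp

theorem posn_injective (e : (n : ℕ) → Fin (n + 1)) (n : ℕ) : Function.Injective (posn e n) := by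
  induction n with
  | zero => exact fun _ _ h => h
  | succ n ih =>
    intro k l
    refine Fin.lastCases ?_ (fun k => ?_) k <;> refine Fin.lastCases ?_ (fun l => ?_) l
    · exact fun _ => rfl
    · rw [posn_last, posn_castSucc]
      exact fun h => absurd h.symm (Fin.succAbove_ne _ _)
    · rw [posn_last, posn_castSucc]
      exact fun h => absurd h (Fin.succAbove_ne _ _)
    · rw [posn_castSucc, posn_castSucc]
      exact fun h => congrArg _ (ih (Fin.succAbove_right_injective h))

/-- `posn e n` as a permutation. -/
def posPerm (e : (n : ℕ) → Fin (n + 1)) (n : ℕ) : Equiv.Perm (Fin (n + 1)) :=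
  Equiv.ofBijective (posn e n) (Finite.injective_iff_bijective.1 (posn_injective e n))

@[simp]
theorem posPerm_apply (e : (n : ℕ) → Fin (n + 1)) (n : ℕ) (k : Fin (n + 1)) :
    posPerm e n k = posn e n k := rfl

/-- The last entry of the permutation is the last insertion, and undoing it leaves the previous
permutation; so the permutation encodes the whole history. -/
theorem eq_of_posPerm_eq {e e' : (n : ℕ) → Fin (n + 1)} {n : ℕ} (h : posPerm e n = posPerm e' n)
    {k : ℕ} (hk : k ≤ n) : e k = e' k := by
  induction n with
  | zero =>
    obtain rfl : k = 0 := by omega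
    exact Subsingleton.elim (α := Fin 1) _ _
  | succ n ih =>
    have hl : e (n + 1) = e' (n + 1) := by
      rw [← posn_last e, ← posn_last e', ← posPerm_apply, h, posPerm_apply]
    rcases hk.eq_or_lt with rfl | hk
    · exact hl
    refine ih (Equiv.ext fun j => ?_) (by omega)
    have := DFunLike.congr_fun h j.castSucc
    rw [posPerm_apply, posPerm_apply, posn_castSucc, posn_castSucc, ← hl] at this
    exact Fin.succAbove_right_injective this

/-- The permutation `σ` without its last entry. -/
theorem exists_perm_succAbove {n : ℕ} (σ : Equiv.Perm (Fin (n + 2))) :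
    ∃ τ : Equiv.Perm (Fin (n + 1)),
      ∀ k, (σ (Fin.last _)).succAbove (τ k) = σ k.castSucc := by
  have h : ∀ k : Fin (n + 1), ∃ l, (σ (Fin.last _)).succAbove l = σ k.castSucc := fun k =>
    Fin.exists_succAbove_eq fun h => absurd (σ.injective h) (Fin.castSucc_lt_last k).ne
  choose f hf using h
  have hinj : Function.Injective f := fun k l hkl => by
    have := hf k
    rw [hkl, hf l] at this
    exact Fin.castSucc_injective _ (σ.injective this).symm
  exact ⟨Equiv.ofBijective f (Finite.injective_iff_bijective.1 hinj), hf⟩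

theorem posPerm_succ_eq_iff {e : (n : ℕ) → Fin (n + 1)} {n : ℕ} {σ : Equiv.Perm (Fin (n + 2))}
    {τ : Equiv.Perm (Fin (n + 1))}
    (hτ : ∀ k, (σ (Fin.last _)).succAbove (τ k) = σ k.castSucc) :
    posPerm e (n + 1) = σ ↔ posPerm e n = τ ∧ e (n + 1) = σ (Fin.last _) := by
  constructor
  · intro h
    have hl : e (n + 1) = σ (Fin.last _) := by
      rw [← posn_last e, ← posPerm_apply, h]
    refine ⟨Equiv.ext fun k => ?_, hl⟩
    refine Fin.succAbove_right_injective (p := e (n + 1)) ?_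
    rw [posPerm_apply, ← posn_castSucc, ← posPerm_apply, h, ← hτ, hl]
  · rintro ⟨h, hl⟩
    refine Equiv.ext fun k => Fin.lastCases ?_ (fun k => ?_) k
    · rw [posPerm_apply, posn_last, hl]
    · rw [posPerm_apply, posn_castSucc, ← posPerm_apply, h, hl, hτ]

/-- The relative ranks of the successive entries of a real sequence. -/
def rankSeq (x : ℕ → ℝ) (n : ℕ) : Fin (n + 1) := lastRank fun k : Fin (n + 1) => x k

/-- The `- 1` in `lastRank` removes the entry itself; injectivity makes the other inequalities
strict. -/
theorem rankSeq_eq_card {x : ℕ → ℝ} (hx : Function.Injective x) (n : ℕ) :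
    (rankSeq x n : ℕ) = ((Finset.range (n + 1)).filter fun j => x j < x n).card := by
  have h1 : (Finset.univ.filter fun k : Fin (n + 1) => x k ≤ x (Fin.last n)).card =
      ((Finset.range (n + 1)).filter fun j => x j ≤ x n).card := by
    simp only [Finset.card_filter, Fin.val_last]
    exact Fin.sum_univ_eq_sum_range (fun j => if x j ≤ x n then 1 else 0) (n + 1)
  have h2 : (Finset.range (n + 1)).filter (fun j => x j ≤ x n) =
      insert n ((Finset.range (n + 1)).filter fun j => x j < x n) := by
    ext j
    simp only [Finset.mem_filter, Finset.mem_range, Finset.mem_insert]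
    constructor
    · rintro ⟨h, h'⟩
      rcases h'.eq_or_lt with h' | h'
      · exact Or.inl (hx h')
      · exact Or.inr ⟨h, h'⟩
    · rintro (rfl | ⟨h, h'⟩)
      · exact ⟨by omega, le_rfl⟩
      · exact ⟨h, h'.le⟩
  simp only [rankSeq, lastRank]
  rw [h1, h2, Finset.card_insert_of_notMem (by simp)]
  simp

/-- Inserting a value at its rank shifts exactly the larger values by one, so a position always
counts the smaller values. -/
theorem posn_rankSeq {x : ℕ → ℝ} (hx : Function.Injective x) (n : ℕ) (k : Fin (n + 1)) :
    (posn (rankSeq x) n k : ℕ) = ((Finset.range (n + 1)).filter fun j => x j < x k).card := by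
  induction n with
  | zero =>
    obtain rfl : k = Fin.last 0 := Subsingleton.elim (α := Fin 1) _ _
    rw [posn_last, rankSeq_eq_card hx]; simp
  | succ n ih =>
    refine Fin.lastCases ?_ (fun k => ?_) k
    · rw [posn_last, rankSeq_eq_card hx]; simp
    have hlast : (rankSeq x (n + 1) : ℕ) =
        ((Finset.range (n + 1)).filter fun j => x j < x (n + 1)).card := by
      rw [rankSeq_eq_card hx, Finset.range_add_one (n := n + 1), Finset.filter_insert,
        if_neg (lt_irrefl _)]
    have hne : x k ≠ x (n + 1) := fun h => by
      have := hx h; omega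
    rw [posn_castSucc, Fin.val_castSucc, Finset.range_add_one (n := n + 1), Finset.filter_insert,
      Fin.succAbove]
    by_cases h : x (n + 1) < x k
    · have hle : ¬ (posn (rankSeq x) n k).castSucc < rankSeq x (n + 1) := by
        rw [Fin.lt_def, Fin.val_castSucc, ih, hlast, not_lt]
        refine Finset.card_le_card fun j hj => ?_
        simp only [Finset.mem_filter] at hj ⊢
        exact ⟨hj.1, hj.2.trans h⟩
      rw [if_neg hle, if_pos h, Finset.card_insert_of_notMem (by simp), Fin.val_succ, ih]
    · have hlt : (posn (rankSeq x) n k).castSucc < rankSeq x (n + 1) := by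
        rw [Fin.lt_def, Fin.val_castSucc, ih, hlast]
        have hk : x k < x (n + 1) := lt_of_le_of_ne (not_lt.1 h) hne
        refine Finset.card_lt_card ⟨fun j hj => ?_, fun hs => ?_⟩
        · simp only [Finset.mem_filter] at hj ⊢
          exact ⟨hj.1, hj.2.trans hk⟩
        · have : (k : ℕ) ∈ (Finset.range (n + 1)).filter fun j => x j < x k := hs (by
            simp only [Finset.mem_filter, Finset.mem_range]; exact ⟨k.isLt, hk⟩)
          simp at this
      rw [if_pos hlt, if_neg h, Fin.val_castSucc, ih]

/-- Relative ranks of an exchanged sequence. -/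
theorem posPerm_rankSeq_swapSeq {x : ℕ → ℝ} (hx : Function.Injective x) {n : ℕ}
    (i j : Fin (n + 1)) :
    posPerm (rankSeq (swapSeq (i : ℕ) j x)) n = posPerm (rankSeq x) n * Equiv.swap i j := by
  have hval : ∀ k : Fin (n + 1),
      Equiv.swap (i : ℕ) (j : ℕ) (k : ℕ) = (Equiv.swap i j k : Fin (n + 1)) := fun k => by
    rw [Equiv.swap_apply_def, Equiv.swap_apply_def]
    split_ifs <;> simp_all [Fin.ext_iff]
  have hx' : Function.Injective (swapSeq (i : ℕ) j x) :=
    hx.comp (Equiv.injective _)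
  refine Equiv.ext fun k => Fin.ext ?_
  rw [posPerm_apply, Equiv.Perm.mul_apply, posPerm_apply, posn_rankSeq hx', posn_rankSeq hx]
  refine Finset.card_bij' (fun l _ => Equiv.swap (i : ℕ) j l) (fun l _ => Equiv.swap (i : ℕ) j l)
    (fun l hl => ?_) (fun l hl => ?_) (fun l _ => by simp) (fun l _ => by simp)
  · simp only [Finset.mem_filter, Finset.mem_range, swapSeq, hval] at hl ⊢
    refine ⟨?_, hl.2⟩
    have := hval ⟨l, hl.1⟩
    simp only at this
    rw [this]; exact Fin.isLt _
  · simp only [Finset.mem_filter, Finset.mem_range, swapSeq, hval] at hl ⊢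
    refine ⟨?_, by simpa using hl.2⟩
    have := hval ⟨l, hl.1⟩
    simp only at this
    rw [this]; exact Fin.isLt _

/-- An injective sequence is sorted by its positions. -/
theorem posn_rankSeq_sort {x : ℕ → ℝ} (hx : Function.Injective x) (n : ℕ) (i : Fin (n + 1)) :
    posn (rankSeq x) n (Tuple.sort (fun k : Fin (n + 1) => x k) i) = i := by
  set f : Fin (n + 1) → ℝ := fun k => x k with hf
  have hinj : Function.Injective f := fun k l h => Fin.ext (hx h)
  have hmono : StrictMono (f ∘ Tuple.sort f) :=
    (Tuple.monotone_sort f).strictMono_of_injective (hinj.comp (Equiv.injective _))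
  refine Fin.ext ?_
  rw [posn_rankSeq hx]
  have h1 : ((Finset.range (n + 1)).filter fun j => x j < x (Tuple.sort f i)).card =
      (Finset.univ.filter fun k : Fin (n + 1) => f k < f (Tuple.sort f i)).card := by
    simp only [Finset.card_filter]
    exact (Fin.sum_univ_eq_sum_range (fun j => if x j < x (Tuple.sort f i) then 1 else 0)
      (n + 1)).symm
  have h2 : (Finset.univ.filter fun k : Fin (n + 1) => f k < f (Tuple.sort f i)).card =
      (Finset.univ.filter fun k : Fin (n + 1) => k < i).card := by
    simp only [Finset.card_filter]
    rw [← Equiv.sum_comp (Tuple.sort f)]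
    exact Finset.sum_congr rfl fun l _ => if_congr hmono.lt_iff_lt rfl rfl
  rw [h1, h2, Finset.filter_gt_eq_Iio]
  exact Fin.card_Iio i

/-- The limiting relative positions of the items. -/
def limPosSeq (e : (n : ℕ) → Fin (n + 1)) (k : ℕ) : ℝ := limPos (fun m => e m) k (e k)

/-- The limiting relative positions recover an injective sequence with uniform empirical
distribution. -/
theorem limPosSeq_rankSeq {x : ℕ → ℝ} (hx : Function.Injective x) (h01 : ∀ k, x k ∈ Set.Icc 0 1)
    (hfreq : ∀ q : ℚ, Tendsto (fun n => freq (Set.Iic (q : ℝ)) n x) atTop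
      (𝓝 (max (min (q : ℝ) 1) 0))) : limPosSeq (rankSeq x) = x := by
  funext k
  refine Tendsto.limsup_eq ?_
  -- The position of item `k` counts the entries below `x k`, so its relative value is squeezed
  -- between empirical distribution functions at rationals on either side of `x k`.
  have h1 : ∀ n, k ≤ n → ((track (fun m => rankSeq x m) k (rankSeq x k) n : ℕ) : ℝ) =
      ((Finset.range (n + 1)).filter fun j => x j < x k).card := by
    intro n hn
    have h := posn_eq_track (rankSeq x) n ⟨k, by omega⟩
    rw [posn_rankSeq hx] at h
    exact_mod_cast h.symm
  have hcard : ∀ (n : ℕ) (q : ℚ), freq (Set.Iic (q : ℝ)) (n + 1) x =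
      (((Finset.range (n + 1)).filter fun j => x j ≤ q).card : ℝ) / ((n : ℝ) + 1) := by
    intro n q
    rw [freq, Finset.card_filter]
    push_cast
    congr 1
  have hpos : ∀ n : ℕ, (0 : ℝ) ≤ (n : ℝ) + 1 := fun n => by positivity
  refine tendsto_order.2 ⟨fun a ha => ?_, fun b hb => ?_⟩
  · obtain ⟨q, hq1, hq2⟩ := exists_rat_btwn ha
    have hlim := (hfreq q).comp (tendsto_add_atTop_nat 1)
    have : a < max (min (q : ℝ) 1) 0 :=
      lt_max_of_lt_left (lt_min hq1 (hq1.trans (hq2.trans_le (h01 k).2)))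
    filter_upwards [hlim.eventually_const_lt this, eventually_ge_atTop k] with n hn hkn
    rw [h1 n hkn]
    refine lt_of_lt_of_le hn ?_
    rw [Function.comp_apply, hcard]
    refine div_le_div_of_nonneg_right ?_ (hpos n)
    exact_mod_cast Finset.card_le_card (Finset.monotone_filter_right _
      fun j _ hj => lt_of_le_of_lt hj hq2)
  · obtain ⟨q, hq1, hq2⟩ := exists_rat_btwn hb
    have hlim := (hfreq q).comp (tendsto_add_atTop_nat 1)
    have : max (min (q : ℝ) 1) 0 < b :=
      max_lt ((min_le_left _ _).trans_lt hq2) ((h01 k).1.trans_lt hb)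
    filter_upwards [hlim.eventually_lt_const this, eventually_ge_atTop k] with n hn hkn
    rw [h1 n hkn]
    refine lt_of_le_of_lt ?_ hn
    rw [Function.comp_apply, hcard]
    refine div_le_div_of_nonneg_right ?_ (hpos n)
    exact_mod_cast Finset.card_le_card (Finset.monotone_filter_right _
      fun j _ (hj : x j < x k) => (hj.trans hq1).le)

end Positions

/-! ### Uniform permutations and the law of the limiting positions -/

section Ranks

theorem measurable_posn {Ω : Type*} {m : MeasurableSpace Ω} {e : (n : ℕ) → Ω → Fin (n + 1)}
    (he : ∀ n, Measurable (e n)) (n : ℕ) (k : Fin (n + 1)) :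
    Measurable fun ω => posn (fun j => e j ω) n k := by
  induction n with
  | zero => exact measurable_const
  | succ n ih =>
    refine Fin.lastCases ?_ (fun k => ?_) k
    · simp_rw [posn_last]; exact he (n + 1)
    · simp_rw [posn_castSucc]
      exact (Measurable.of_discrete (f := fun p : Fin (n + 2) × Fin (n + 1) =>
        p.1.succAbove p.2)).comp ((he (n + 1)).prodMk (ih k))

theorem measurableSet_posPerm_eq {Ω : Type*} {m : MeasurableSpace Ω}
    {e : (n : ℕ) → Ω → Fin (n + 1)} (he : ∀ n, Measurable (e n)) (n : ℕ)
    (σ : Equiv.Perm (Fin (n + 1))) :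
    MeasurableSet {ω | posPerm (fun j => e j ω) n = σ} := by
  have : {ω | posPerm (fun j => e j ω) n = σ} =
      ⋂ k, (fun ω => posn (fun j => e j ω) n k) ⁻¹' {σ k} := by
    ext ω
    simp [Equiv.ext_iff]
  rw [this]
  exact MeasurableSet.iInter fun k => measurable_posn he n k (measurableSet_singleton _)

/-- A law on sequences of ranks is determined by the laws of the permutations. -/
theorem ext_of_measure_posPerm_eq {Q Q' : Measure ((n : ℕ) → Fin (n + 1))}
    [IsProbabilityMeasure Q] [IsProbabilityMeasure Q']
    (h : ∀ n σ, Q {e | posPerm e n = σ} = Q' {e | posPerm e n = σ}) : Q = Q' := by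
  refine ext_of_generate_finite _ generateFrom_squareCylinders.symm
    (isPiSystem_squareCylinders (fun _ => MeasurableSpace.isPiSystem_measurableSet)
      fun n => show MeasurableSet (Set.univ : Set (Fin (n + 1))) from MeasurableSet.univ)
      ?_ (by simp)
  rintro _ ⟨s, t, -, rfl⟩
  obtain ⟨n, hn⟩ : ∃ n, s ⊆ Finset.range n := s.exists_nat_subset_range
  -- A rectangle constrains coordinates below `n` only, and these are functions of the permutation;
  -- hence it is a finite disjoint union of permutation events.
  have hset : (s : Set ℕ).pi t = ⋃ σ ∈ (fun e => posPerm e n) '' (s : Set ℕ).pi t,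
      {e | posPerm e n = σ} := by
    ext e
    simp only [Set.mem_image, Set.mem_iUnion, Set.mem_ofPred_eq, exists_prop]
    constructor
    · exact fun he => ⟨_, ⟨e, he, rfl⟩, rfl⟩
    · rintro ⟨_, ⟨e', he', rfl⟩, h⟩ k hk
      have hk' := Finset.mem_range.1 (hn hk)
      rw [eq_of_posPerm_eq h hk'.le]
      exact he' k hk
  rw [hset]
  have hd : ((fun e => posPerm e n) '' (s : Set ℕ).pi t).PairwiseDisjoint
      fun σ => {e | posPerm e n = σ} := fun σ _ τ _ hστ =>
    Set.disjoint_left.2 fun e h1 h2 => hστ (h1.symm.trans h2)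
  have hm : ∀ σ ∈ (fun e => posPerm e n) '' (s : Set ℕ).pi t,
      MeasurableSet {e : (n : ℕ) → Fin (n + 1) | posPerm e n = σ} := fun σ _ =>
    measurableSet_posPerm_eq (fun n => measurable_pi_apply n) n σ
  rw [measure_biUnion (Set.to_countable _) hd hm, measure_biUnion (Set.to_countable _) hd hm]
  exact tsum_congr fun σ => h n σ

theorem exchangeable_iidLaw {E : Type*} [MeasurableSpace E] (ρ : ProbabilityMeasure E) :
    Exchangeable (iidLaw ρ) := by
  intro i j
  have h := Measure.infinitePi_map_piCongrLeft (μ := fun _ : ℕ => (ρ : Measure E))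
    (Equiv.swap i j)
  have e : (MeasurableEquiv.piCongrLeft (fun _ : ℕ => E) (Equiv.swap i j) :
      (ℕ → E) → ℕ → E) = swapSeq i j := by
    funext z k
    obtain ⟨l, rfl⟩ := (Equiv.swap i j).surjective k
    rw [MeasurableEquiv.coe_piCongrLeft, Equiv.piCongrLeft_apply_apply]
    simp [swapSeq]
  rw [e] at h
  exact h

theorem measurable_rankSeq : Measurable rankSeq := by
  refine measurable_pi_lambda _ fun n => (measurable_lastRank n).comp ?_
  fun_prop

/-- The uniform distribution as an element of the space of probability measures. -/
abbrev unifLaw : ProbabilityMeasure ℝ := ⟨unif, inferInstance⟩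

theorem measurePreserving_eval_iidLaw {E : Type*} [MeasurableSpace E] (ρ : ProbabilityMeasure E)
    (k : ℕ) : MeasurePreserving (fun z : ℕ → E => z k) (iidLaw ρ) (ρ : Measure E) :=
  measurePreserving_eval_infinitePi (fun _ : ℕ => (ρ : Measure E)) k

theorem ae_injective_iidLaw_unif : ∀ᵐ x ∂iidLaw unifLaw, Function.Injective x := by
  have h : ∀ i j : ℕ, i ≠ j → ∀ᵐ x ∂iidLaw unifLaw, x i ≠ x j := by
    intro i j hij
    have hindep : iIndepFun (fun (k : ℕ) (x : ℕ → ℝ) => x k) (iidLaw unifLaw) :=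
      iIndepFun_infinitePi (P := fun _ : ℕ => (unifLaw : Measure ℝ)) (X := fun _ x => x)
        fun _ => measurable_id
    have hpair := (indepFun_iff_map_prod_eq_prod_map_map
      (measurable_pi_apply i).aemeasurable (measurable_pi_apply j).aemeasurable).1
      (hindep.indepFun hij)
    rw [(measurePreserving_eval_iidLaw unifLaw i).map_eq,
      (measurePreserving_eval_iidLaw unifLaw j).map_eq] at hpair
    have hdiag : MeasurableSet {p : ℝ × ℝ | p.1 = p.2} :=
      measurableSet_eq_fun measurable_fst measurable_snd
    have h0 : (unif.prod unif) {p : ℝ × ℝ | p.1 = p.2} = 0 := by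
      rw [Measure.measure_prod_null hdiag]
      refine Eventually.of_forall fun x => ?_
      have : Prod.mk x ⁻¹' {p : ℝ × ℝ | p.1 = p.2} = {x} := by
        ext y; simp [eq_comm]
      change unif (Prod.mk x ⁻¹' {p : ℝ × ℝ | p.1 = p.2}) = 0
      rw [this]
      simp
    have h1 : ((iidLaw unifLaw).map fun x => (x i, x j)) {p : ℝ × ℝ | p.1 = p.2} = 0 := by
      rw [hpair]; exact h0
    rw [Measure.map_apply (by fun_prop) hdiag] at h1
    rw [ae_iff]
    simpa using h1
  have h' : ∀ᵐ x ∂iidLaw unifLaw, ∀ i j : ℕ, i ≠ j → x i ≠ x j := by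
    rw [ae_all_iff]; intro i
    rw [ae_all_iff]; intro j
    rcases eq_or_ne i j with hij | hij
    · exact Eventually.of_forall fun _ hne => absurd hij hne
    · filter_upwards [h i j hij] with x hx _ using hx
  filter_upwards [h'] with x hx i j hij
  by_contra hne
  exact hx i j hne hij

theorem sum_measure_posPerm_eq {Q : Measure ((n : ℕ) → Fin (n + 1))} [IsProbabilityMeasure Q]
    (n : ℕ) : ∑ σ, Q {e | posPerm e n = σ} = 1 := by
  have hU : ⋃ σ ∈ (Finset.univ : Finset (Equiv.Perm (Fin (n + 1)))),
      {e : (n : ℕ) → Fin (n + 1) | posPerm e n = σ} = Set.univ := by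
    ext e; simp
  rw [← measure_biUnion_finset (fun σ _ τ _ hστ =>
    Set.disjoint_left.2 fun e h1 h2 => hστ (h1.symm.trans h2))
    (fun σ _ => measurableSet_posPerm_eq (fun n => measurable_pi_apply n) n σ), hU, measure_univ]

/-- Exchangeability of the uniform sequence makes the weights invariant under right multiplication
by transpositions. These generate the group, so the weights are equal. -/
theorem measure_posPerm_rankSeq (n : ℕ) (σ : Equiv.Perm (Fin (n + 1))) :
    ((iidLaw unifLaw).map rankSeq) {e | posPerm e n = σ} = ((n + 1).factorial : ENNReal)⁻¹ := by
  have : IsProbabilityMeasure ((iidLaw unifLaw).map rankSeq) :=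
    Measure.isProbabilityMeasure_map measurable_rankSeq.aemeasurable
  have hm : ∀ σ, MeasurableSet {e : (n : ℕ) → Fin (n + 1) | posPerm e n = σ} := fun σ =>
    measurableSet_posPerm_eq (fun n => measurable_pi_apply n) n σ
  set f : Equiv.Perm (Fin (n + 1)) → ENNReal := fun σ =>
    ((iidLaw unifLaw).map rankSeq) {e | posPerm e n = σ} with hf
  have hf' : ∀ σ, f σ = iidLaw unifLaw {x | posPerm (rankSeq x) n = σ} := fun σ => by
    rw [hf]; simp only
    rw [Measure.map_apply measurable_rankSeq (hm σ)]
    rfl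
  have hswap : ∀ σ i j, f (σ * Equiv.swap i j) = f σ := by
    intro σ i j
    rw [hf', hf']
    conv_rhs => rw [← exchangeable_iidLaw unifLaw i j]
    have hm' : MeasurableSet {x | posPerm (rankSeq x) n = σ} := measurable_rankSeq (hm σ)
    rw [Measure.map_apply (measurable_swapSeq _ _) hm']
    refine measure_congr ?_
    filter_upwards [ae_injective_iidLaw_unif] with x hx
    refine propext ?_
    change posPerm (rankSeq x) n = σ * Equiv.swap i j ↔
      posPerm (rankSeq (swapSeq (i : ℕ) j x)) n = σ
    rw [posPerm_rankSeq_swapSeq hx]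
    constructor
    · intro h; rw [h, mul_assoc, Equiv.swap_mul_self, mul_one]
    · intro h; rw [← h, mul_assoc, Equiv.swap_mul_self, mul_one]
  have hconst : ∀ σ, f σ = f 1 := fun σ => by
    induction σ using Equiv.Perm.swap_induction_on' with
    | one => rfl
    | mul_swap σ i j _ ih => rw [hswap, ih]
  have hsum : ∑ σ, f σ = 1 := sum_measure_posPerm_eq n
  simp_rw [hconst] at hsum
  rw [Finset.sum_const, Finset.card_univ, Fintype.card_perm, Fintype.card_fin,
    nsmul_eq_mul] at hsum
  change f σ = _
  rw [hconst]
  exact ENNReal.eq_inv_of_mul_eq_one_left (by rw [mul_comm]; exact hsum)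

theorem measurable_track {Ω : Type*} {m : MeasurableSpace Ω} {e : ℕ → Ω → ℕ} {k : ℕ}
    (he : ∀ j, k < j → Measurable (e j)) (r n : ℕ) :
    Measurable fun ω => track (fun j => e j ω) k r n := by
  induction n with
  | zero => exact measurable_const
  | succ n ih =>
    simp only [track]
    by_cases h : n + 1 ≤ k
    · simp only [h, if_true]; exact measurable_const
    · simp only [h, if_false]
      exact Measurable.ite (measurableSet_le (he _ (by omega)) ih) (ih.add_const 1) ih

theorem measurable_limPos {Ω : Type*} {m : MeasurableSpace Ω} {e : ℕ → Ω → ℕ} {k : ℕ}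
    (he : ∀ j, k < j → Measurable (e j)) (r : ℕ) :
    Measurable fun ω => limPos (fun j => e j ω) k r := by
  refine Measurable.limsup fun n => ?_
  have h : Measurable fun ω => ((track (fun j => e j ω) k r n : ℕ) : ℝ) :=
    (Measurable.of_discrete (f := fun a : ℕ => (a : ℝ))).comp (measurable_track he r n)
  exact h.div_const _

theorem measurable_eval_comp {Ω ι β : Type*} {m : MeasurableSpace Ω} [MeasurableSpace β]
    [MeasurableSpace ι] [MeasurableSingletonClass ι] [Countable ι] {F : Ω → ι → β} {g : Ω → ι}
    (hF : ∀ i, Measurable fun ω => F ω i) (hg : Measurable g) :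
    Measurable fun ω => F ω (g ω) :=
  (measurable_from_prod_countable_left (f := fun p : Ω × ι => F p.1 p.2) hF).comp
    (measurable_id.prodMk hg)

/-- Measurability is asked only from time `k` on: this is what later places items in the backward
field. -/
theorem measurable_limPosSeq_comp {Ω : Type*} {m : MeasurableSpace Ω}
    {e : (n : ℕ) → Ω → Fin (n + 1)} {k : ℕ} (he : ∀ j, k ≤ j → Measurable (e j)) :
    Measurable fun ω => limPosSeq (fun j => e j ω) k := by
  have he' : ∀ j, k < j → Measurable fun ω => ((e j ω : Fin (j + 1)) : ℕ) := fun j hj =>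
    (Measurable.of_discrete (f := fun a : Fin (j + 1) => (a : ℕ))).comp (he j hj.le)
  exact measurable_eval_comp (F := fun ω (r : Fin (k + 1)) => limPos (fun j => e j ω) k r)
    (fun r => measurable_limPos he' r) (he k le_rfl)

theorem measurable_limPosSeq : Measurable limPosSeq :=
  measurable_pi_lambda _ fun _ =>
    measurable_limPosSeq_comp (e := fun n (e : (n : ℕ) → Fin (n + 1)) => e n)
      fun j _ => measurable_pi_apply j

theorem ae_limPosSeq_rankSeq : ∀ᵐ x ∂iidLaw unifLaw, limPosSeq (rankSeq x) = x := by
  have h01 : ∀ᵐ x ∂iidLaw unifLaw, ∀ k, x k ∈ Set.Icc (0 : ℝ) 1 := by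
    refine ae_all_iff.2 fun _ => ?_
    exact (measurePreserving_eval_iidLaw unifLaw _).quasiMeasurePreserving.ae
      (ae_restrict_mem measurableSet_Icc)
  have hfreq : ∀ᵐ x ∂iidLaw unifLaw, ∀ q : ℚ, Tendsto (fun n => freq (Set.Iic (q : ℝ)) n x) atTop
      (𝓝 (max (min (q : ℝ) 1) 0)) := by
    refine ae_all_iff.2 fun q => ?_
    have := ae_tendsto_freq_iidLaw unifLaw (measurableSet_Iic (a := (q : ℝ)))
    rwa [ProbabilityMeasure.coe_mk, unif_Iic, ENNReal.toReal_ofReal'] at this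
  filter_upwards [ae_injective_iidLaw_unif, h01, hfreq] with x h1 h2 h3
  exact limPosSeq_rankSeq h1 h2 h3

/-- If the permutations built from a random rank sequence are uniform, then the limiting relative
positions are i.i.d. uniform and determine the rank sequence. -/
theorem map_limPosSeq_eq {Q : Measure ((n : ℕ) → Fin (n + 1))} [IsProbabilityMeasure Q]
    (hQ : ∀ n σ, Q {e | posPerm e n = σ} = ((n + 1).factorial : ENNReal)⁻¹) :
    Q.map limPosSeq = iidLaw unifLaw ∧ ∀ᵐ e ∂Q, rankSeq (limPosSeq e) = e := by
  have : IsProbabilityMeasure ((iidLaw unifLaw).map rankSeq) :=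
    Measure.isProbabilityMeasure_map measurable_rankSeq.aemeasurable
  -- Once `Q` is the law of ranks of i.i.d. uniforms, both claims can be checked in that model,
  -- where limiting positions return the uniforms.
  have h : Q = (iidLaw unifLaw).map rankSeq :=
    ext_of_measure_posPerm_eq fun n σ => by rw [hQ, measure_posPerm_rankSeq]
  rw [h]
  constructor
  · rw [Measure.map_map measurable_limPosSeq measurable_rankSeq]
    conv_rhs => rw [← Measure.map_id (μ := iidLaw unifLaw)]
    exact Measure.map_congr ae_limPosSeq_rankSeq
  · have hm : MeasurableSet {e | rankSeq (limPosSeq e) = e} :=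
      measurableSet_eq_fun (measurable_rankSeq.comp measurable_limPosSeq) measurable_id
    rw [ae_map_iff measurable_rankSeq.aemeasurable hm]
    filter_upwards [ae_limPosSeq_rankSeq] with x hx
    rw [hx]

end Ranks

/-! ### Items of an erased-word process and existence of the directing measure -/

section ErasedWords

variable {Ω A : Type*} {W : (n : ℕ) → Ω → Fin (n + 1) → A} {η : (n : ℕ) → Ω → Fin (n + 1)}

/-- The letters with their limiting relative positions, in the order of insertion. -/
def itemSeq (W : (n : ℕ) → Ω → Fin (n + 1) → A) (η : (n : ℕ) → Ω → Fin (n + 1)) (ω : Ω)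
    (k : ℕ) : A × ℝ :=
  (W k ω (η k ω), limPosSeq (fun j => η j ω) k)

/-- The sequence of items, if the permutation at time `n` is replaced by `σ`. -/
def itemSeqPerm (W : (n : ℕ) → Ω → Fin (n + 1) → A) (η : (n : ℕ) → Ω → Fin (n + 1)) (n : ℕ)
    (σ : Equiv.Perm (Fin (n + 1))) (ω : Ω) (k : ℕ) : A × ℝ :=
  if h : k < n + 1 then (W n ω (σ ⟨k, h⟩), limPos (fun j => η j ω) n (σ ⟨k, h⟩))
  else itemSeq W η ω k

theorem swapSeq_itemSeqPerm {n : ℕ} (i j : Fin (n + 1)) (σ : Equiv.Perm (Fin (n + 1))) (ω : Ω) :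
    swapSeq (i : ℕ) j (itemSeqPerm W η n σ ω) = itemSeqPerm W η n (σ * Equiv.swap i j) ω := by
  funext k
  by_cases hk : k < n + 1
  · have hval : Equiv.swap (i : ℕ) (j : ℕ) k = (Equiv.swap i j ⟨k, hk⟩ : Fin (n + 1)) := by
      rw [Equiv.swap_apply_def, Equiv.swap_apply_def]
      split_ifs <;> simp_all [Fin.ext_iff]
    simp only [swapSeq, hval, itemSeqPerm, hk, dif_pos, Fin.is_lt, Fin.eta,
      Equiv.Perm.mul_apply]
  · have hval : Equiv.swap (i : ℕ) (j : ℕ) k = k :=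
      Equiv.swap_apply_of_ne_of_ne (by omega) (by omega)
    simp only [swapSeq, hval, itemSeqPerm, hk, dif_neg, not_false_eq_true]

variable [MeasurableSpace A]

theorem backwardField_anti {m n : ℕ} (h : m ≤ n) :
    backwardField W η n ≤ backwardField W η m :=
  iSup_mono fun _ => iSup_le fun hk => le_iSup_of_le (h.trans hk) le_rfl

theorem measurable_backwardField_word {n k : ℕ} (h : n ≤ k) :
    Measurable[backwardField W η n] (W k) :=
  measurable_iff_comap_le.2 (le_iSup_of_le k (le_iSup_of_le h le_sup_left))

theorem measurable_backwardField_eraser {n k : ℕ} (h : n < k) :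
    Measurable[backwardField W η n] (η k) := by
  obtain ⟨k, rfl⟩ : ∃ j, k = j + 1 := ⟨k - 1, by omega⟩
  exact measurable_iff_comap_le.2
    (le_iSup_of_le k (le_iSup_of_le (Nat.le_of_lt_succ h) le_sup_right))

theorem measurable_itemSeq_apply {m : MeasurableSpace Ω} {k : ℕ} (hW : Measurable[m] (W k))
    (hη : ∀ j, k ≤ j → Measurable[m] (η j)) : Measurable[m] fun ω => itemSeq W η ω k :=
  (measurable_eval_comp (fun i => (measurable_pi_apply i).comp hW) (hη k le_rfl)).prodMk
    (measurable_limPosSeq_comp hη)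

/-- With `σ` fixed, the items up to `n` are read off from `W n` and the erasers after `n`; later
items involve later times only. -/
theorem measurable_itemSeqPerm (n : ℕ) (σ : Equiv.Perm (Fin (n + 1))) :
    Measurable[backwardField W η n] (itemSeqPerm W η n σ) := by
  refine @measurable_pi_lambda _ _ _ (backwardField W η n) _ _ fun k => ?_
  unfold itemSeqPerm
  split_ifs with hk
  · refine Measurable.prodMk ((measurable_pi_apply _).comp
      (measurable_backwardField_word le_rfl)) ?_
    refine measurable_limPos (fun j hj => ?_) _
    exact (Measurable.of_discrete (f := fun a : Fin (j + 1) => (a : ℕ))).comp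
      (measurable_backwardField_eraser hj)
  · exact measurable_itemSeq_apply (measurable_backwardField_word (by omega))
      fun j hj => measurable_backwardField_eraser (by omega)

variable [MeasurableSpace Ω] {μ : Measure Ω}

theorem IsGEWP.backwardField_le (h : IsGEWP μ W η) (n : ℕ) :
    backwardField W η n ≤ ‹MeasurableSpace Ω› :=
  iSup_le fun k => iSup_le fun _ =>
    sup_le (h.measurable_word k).comap_le (h.measurable_eraser (k + 1)).comap_le

/-- The permutation at time `n` is uniform and independent of the backward field. -/
theorem IsGEWP.measure_posPerm_inter [IsProbabilityMeasure μ] (h : IsGEWP μ W η) (n : ℕ)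
    (σ : Equiv.Perm (Fin (n + 1))) {F : Set Ω} (hF : MeasurableSet[backwardField W η n] F) :
    μ ({ω | posPerm (fun j => η j ω) n = σ} ∩ F) = ((n + 1).factorial : ENNReal)⁻¹ * μ F := by
  induction n generalizing F with
  | zero =>
    have : {ω | posPerm (fun j => η j ω) 0 = σ} = Set.univ := by
      refine Set.eq_univ_of_forall fun ω => Equiv.ext fun k => ?_
      exact Subsingleton.elim (α := Fin 1) _ _
    rw [this, Set.univ_inter]; simp
  | succ n ih =>
    obtain ⟨τ, hτ⟩ := exists_perm_succAbove σ
    -- The last insertion is split off and joined to `F`; the new event lies in the backward field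
    -- of time `n`, so the induction hypothesis applies, followed by independence of `η (n + 1)`.
    have hset : {ω | posPerm (fun j => η j ω) (n + 1) = σ} ∩ F =
        {ω | posPerm (fun j => η j ω) n = τ} ∩ ({ω | η (n + 1) ω = σ (Fin.last _)} ∩ F) := by
      ext ω
      simp only [Set.mem_inter_iff, Set.mem_ofPred_eq, posPerm_succ_eq_iff hτ, and_assoc]
    have hη : MeasurableSet[MeasurableSpace.comap (η (n + 1)) inferInstance]
        {ω | η (n + 1) ω = σ (Fin.last _)} := ⟨{σ (Fin.last _)}, measurableSet_singleton _, rfl⟩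
    have hη' : MeasurableSet[backwardField W η n] {ω | η (n + 1) ω = σ (Fin.last _)} :=
      measurable_backwardField_eraser (Nat.lt_succ_self n) (measurableSet_singleton _)
    rw [hset, ih τ (hη'.inter (backwardField_anti (Nat.le_succ n) F hF)),
      (Indep_iff _ _ μ).1 (h.indep (n + 1)) _ _ hη hF, h.uniform, ← mul_assoc,
      Nat.factorial_succ (n + 1)]
    congr 1
    rw [Nat.cast_mul, ENNReal.mul_inv (Or.inr (ENNReal.natCast_ne_top _))
      (Or.inl (ENNReal.natCast_ne_top _)), mul_comm]

/-- Averaging over the permutation at time `n`. -/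
theorem IsGEWP.measure_posPerm_mem [IsProbabilityMeasure μ] (h : IsGEWP μ W η) (n : ℕ)
    {G : Equiv.Perm (Fin (n + 1)) → Set Ω} (hG : ∀ σ, MeasurableSet[backwardField W η n] (G σ)) :
    μ {ω | ω ∈ G (posPerm (fun j => η j ω) n)} =
      ∑ σ, ((n + 1).factorial : ENNReal)⁻¹ * μ (G σ) := by
  have hU : {ω | ω ∈ G (posPerm (fun j => η j ω) n)} =
      ⋃ σ ∈ (Finset.univ : Finset (Equiv.Perm (Fin (n + 1)))),
        {ω | posPerm (fun j => η j ω) n = σ} ∩ G σ := by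
    ext ω; simp
  rw [hU, measure_biUnion_finset]
  · exact Finset.sum_congr rfl fun σ _ => h.measure_posPerm_inter n σ (hG σ)
  · exact fun σ _ τ _ hστ => Set.disjoint_left.2 fun e h1 h2 => hστ (h1.1.symm.trans h2.1)
  · exact fun σ _ => (measurableSet_posPerm_eq h.measurable_eraser n σ).inter
      (h.backwardField_le n _ (hG σ))

/-- Insertions move items but do not change their letters. -/
theorem IsGEWP.ae_word_posn (h : IsGEWP μ W η) :
    ∀ᵐ ω ∂μ, ∀ n (k : Fin (n + 1)), W n ω (posn (fun j => η j ω) n k) = W k ω (η k ω) := by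
  filter_upwards [ae_all_iff.2 h.erase] with ω hω n
  induction n with
  | zero =>
    intro k
    obtain rfl : k = Fin.last 0 := Subsingleton.elim (α := Fin 1) _ _
    rw [posn_last]; rfl
  | succ n ih =>
    intro k
    refine Fin.lastCases ?_ (fun k => ?_) k
    · rw [posn_last]; rfl
    · rw [posn_castSucc, Fin.val_castSucc, ← ih k, hω n]; rfl

/-- Letter and limiting position of an item can be computed from its place at any later time, hence
from the permutation at time `n`. -/
theorem IsGEWP.ae_itemSeq_eq (h : IsGEWP μ W η) (n : ℕ) :
    ∀ᵐ ω ∂μ, itemSeq W η ω = itemSeqPerm W η n (posPerm (fun j => η j ω) n) ω := by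
  filter_upwards [h.ae_word_posn] with ω hω
  funext k
  unfold itemSeqPerm
  split_ifs with hk
  · rw [posPerm_apply, hω, posn_eq_track, limPos_track _ (Nat.le_of_lt_succ hk)]
    rfl
  · rfl

theorem IsGEWP.measurable_itemSeq (h : IsGEWP μ W η) : Measurable (itemSeq W η) :=
  measurable_pi_lambda _ fun k =>
    measurable_itemSeq_apply (h.measurable_word k) fun j _ => h.measurable_eraser j

theorem IsGEWP.exchangeable_itemSeq [IsProbabilityMeasure μ] (h : IsGEWP μ W η) :
    Exchangeable (μ.map (itemSeq W η)) := by
  intro i j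
  ext S hS
  obtain ⟨n, hi, hj⟩ : ∃ n, i < n + 1 ∧ j < n + 1 := ⟨max i j, by omega, by omega⟩
  have hS' : MeasurableSet (swapSeq i j ⁻¹' S) := measurable_swapSeq i j hS
  rw [Measure.map_apply (measurable_swapSeq i j) hS, Measure.map_apply h.measurable_itemSeq hS',
    Measure.map_apply h.measurable_itemSeq hS]
  have key : ∀ T : Set (ℕ → A × ℝ), MeasurableSet T → μ (itemSeq W η ⁻¹' T) =
      ∑ σ, ((n + 1).factorial : ENNReal)⁻¹ * μ (itemSeqPerm W η n σ ⁻¹' T) := by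
    intro T hT
    rw [← h.measure_posPerm_mem n (G := fun σ => itemSeqPerm W η n σ ⁻¹' T)
      fun σ => measurable_itemSeqPerm n σ hT]
    refine measure_congr ?_
    filter_upwards [h.ae_itemSeq_eq n] with ω hω
    refine propext ?_
    change itemSeq W η ω ∈ T ↔ itemSeqPerm W η n (posPerm (fun j => η j ω) n) ω ∈ T
    rw [← hω]
  -- Exchanging two items only reindexes the average over permutations.
  rw [key _ hS', key _ hS, ← Equiv.sum_comp (Equiv.mulRight (Equiv.swap
    (⟨i, hi⟩ : Fin (n + 1)) ⟨j, hj⟩))]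
  refine Finset.sum_congr rfl fun σ _ => ?_
  congr 2
  ext ω
  rw [Set.mem_preimage, Set.mem_preimage, Set.mem_preimage, Equiv.coe_mulRight,
    ← swapSeq_itemSeqPerm ⟨i, hi⟩ ⟨j, hj⟩, swapSeq_swapSeq]

theorem IsGEWP.limPosSeq_law [IsProbabilityMeasure μ] (h : IsGEWP μ W η) :
    μ.map (fun ω => limPosSeq fun j => η j ω) = iidLaw unifLaw ∧
      ∀ᵐ ω ∂μ, rankSeq (limPosSeq fun j => η j ω) = fun j => η j ω := by
  have hm : Measurable fun ω j => η j ω := measurable_pi_lambda _ h.measurable_eraser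
  have : IsProbabilityMeasure (μ.map fun ω j => η j ω) :=
    Measure.isProbabilityMeasure_map hm.aemeasurable
  obtain ⟨h1, h2⟩ := map_limPosSeq_eq (Q := μ.map fun ω j => η j ω) fun n σ => by
    rw [Measure.map_apply hm (measurableSet_posPerm_eq (fun n => measurable_pi_apply n) n σ)]
    have := h.measure_posPerm_inter n σ (F := Set.univ) MeasurableSet.univ
    rw [Set.inter_univ, measure_univ, mul_one] at this
    exact this
  rw [Measure.map_map measurable_limPosSeq hm] at h1
  exact ⟨h1, ae_of_ae_map hm.aemeasurable h2⟩

/-- The path is built from the sequence of items. -/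
theorem IsGEWP.ae_pathOfSeq_itemSeq [IsProbabilityMeasure μ] (h : IsGEWP μ W η) :
    ∀ᵐ ω ∂μ, pathOfSeq (itemSeq W η ω) = path W η ω := by
  obtain ⟨h1, h2⟩ := h.limPosSeq_law
  have hinj : ∀ᵐ ω ∂μ, Function.Injective (limPosSeq fun j => η j ω) := by
    refine ae_of_ae_map (mβ := MeasurableSpace.pi) (f := fun ω => limPosSeq fun j => η j ω)
      (p := Function.Injective) ?_ ?_
    · exact (measurable_limPosSeq.comp
        (measurable_pi_lambda _ h.measurable_eraser)).aemeasurable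
    · rw [h1]; exact ae_injective_iidLaw_unif
  filter_upwards [h2, hinj, h.ae_word_posn] with ω hrank hinj hword
  funext n
  refine Prod.ext ?_ ?_
  · funext i
    -- The item sorted to place `i` by its limiting position is the item at position `i` in `W n`.
    have hs := posn_rankSeq_sort hinj n i
    rw [hrank] at hs
    change W _ ω (η _ ω) = W n ω i
    rw [← hword n]
    exact congrArg (W n ω) hs
  · exact congrFun hrank n

/-- The strong law for the i.i.d. uniform limiting positions; it identifies the second marginal of
the directing measure. -/
theorem IsGEWP.ae_freq_itemSeq [IsProbabilityMeasure μ] (h : IsGEWP μ W η) (q : ℝ) :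
    ∀ᵐ ω ∂μ, limFreq (Set.univ ×ˢ Set.Iic q) (itemSeq W η ω) = max (min q 1) 0 := by
  have h4 : Tendsto (fun j : ℕ => 4 ^ j) atTop (atTop : Filter ℕ) :=
    tendsto_pow_atTop_atTop_of_one_lt (by norm_num)
  have hlim : ∀ᵐ ω ∂μ, Tendsto (fun n => freq (Set.Iic q) n (limPosSeq fun j => η j ω)) atTop
      (𝓝 (max (min q 1) 0)) := by
    refine ae_of_ae_map (mβ := MeasurableSpace.pi) (f := fun ω => limPosSeq fun j => η j ω)
      (p := fun x => Tendsto (fun n => freq (Set.Iic q) n x) atTop (𝓝 (max (min q 1) 0))) ?_ ?_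
    · exact (measurable_limPosSeq.comp
        (measurable_pi_lambda _ h.measurable_eraser)).aemeasurable
    · rw [h.limPosSeq_law.1]
      have := ae_tendsto_freq_iidLaw unifLaw (measurableSet_Iic (a := q))
      rwa [ProbabilityMeasure.coe_mk, unif_Iic, ENNReal.toReal_ofReal'] at this
  filter_upwards [hlim] with ω hω
  refine Tendsto.limsup_eq ((hω.comp h4).congr fun j => ?_)
  simp [freq, ind, itemSeq, Set.indicator]

theorem exists_mem_uniformMarginal [Nonempty A] :
    ∃ ρ : ProbabilityMeasure (A × ℝ), ρ ∈ uniformMarginal A := by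
  obtain ⟨a⟩ := ‹Nonempty A›
  refine ⟨⟨(Measure.dirac a).prod unif, inferInstance⟩, fun t ht => ?_⟩
  simp [Measure.prod_prod, -Measure.restrict_apply, unif_Icc ht]

theorem mem_uniformMarginal_of_forall_rat {ρ : ProbabilityMeasure (A × ℝ)}
    (h : ∀ q : ℚ, ((ρ : Measure (A × ℝ)) (Set.univ ×ˢ Set.Iic (q : ℝ))).toReal =
      max (min (q : ℝ) 1) 0) : ρ ∈ uniformMarginal A := by
  have : IsProbabilityMeasure ((ρ : Measure (A × ℝ)).map Prod.snd) :=
    Measure.isProbabilityMeasure_map measurable_snd.aemeasurable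
  rw [mem_uniformMarginal_iff]
  refine ext_of_generate_finite _
    ((BorelSpace.measurable_eq (α := ℝ)).trans Real.borel_eq_generateFrom_Iic_rat)
    Real.isPiSystem_Iic_rat ?_ (by simp)
  intro s hs
  simp only [Set.mem_iUnion, Set.mem_singleton_iff] at hs
  obtain ⟨q, rfl⟩ := hs
  rw [Measure.map_apply measurable_snd measurableSet_Iic, ← Set.univ_prod, unif_Iic,
    ← ENNReal.toReal_eq_toReal_iff' (measure_ne_top _ _) ENNReal.ofReal_ne_top, h q,
    ENNReal.toReal_ofReal']

theorem IsGEWP.exists_isDirectingMeasure [StandardBorelSpace A] [IsProbabilityMeasure μ]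
    (h : IsGEWP μ W η) : ∃ Ξ : Ω → uniformMarginal A, IsDirectingMeasure μ W η Ξ := by
  have hZ := h.measurable_itemSeq
  have hP : IsProbabilityMeasure (μ.map (itemSeq W η)) :=
    Measure.isProbabilityMeasure_map hZ.aemeasurable
  obtain ⟨Θ, hΘ, hlim, hjoint⟩ := h.exchangeable_itemSeq.exists_directing
  have hΘ' : Measurable Θ := hΘ.mono permField_le le_rfl
  have : Nonempty A := by
    obtain ⟨ω⟩ : Nonempty Ω := nonempty_of_isProbabilityMeasure μ
    exact ⟨W 0 ω 0⟩
  obtain ⟨ρ, hρ⟩ := exists_mem_uniformMarginal (A := A)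
  have hmem : ∀ᵐ ω ∂μ, Θ (itemSeq W η ω) ∈ uniformMarginal A := by
    have h1 : ∀ᵐ ω ∂μ, ∀ q : ℚ, ((Θ (itemSeq W η ω) : Measure (A × ℝ))
        (Set.univ ×ˢ Set.Iic (q : ℝ))).toReal = max (min (q : ℝ) 1) 0 := by
      refine ae_all_iff.2 fun q => ?_
      filter_upwards [ae_of_ae_map hZ.aemeasurable
        (hlim _ (MeasurableSet.univ.prod (measurableSet_Iic (a := (q : ℝ))))),
        h.ae_freq_itemSeq q] with ω h1 h2
      rw [h1, h2]
    filter_upwards [h1] with ω hω using mem_uniformMarginal_of_forall_rat hω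
  -- `Ξ` must lie in `uniformMarginal A` everywhere, so it is redefined as a fixed `ρ` on a
  -- measurable null set.
  set N := toMeasurable μ {ω | Θ (itemSeq W η ω) ∉ uniformMarginal A} with hN
  have hNm : MeasurableSet N := measurableSet_toMeasurable _ _
  have hN0 : μ N = 0 := by rw [hN, measure_toMeasurable]; exact hmem
  have hsub : ∀ ω, ω ∉ N → Θ (itemSeq W η ω) ∈ uniformMarginal A := fun ω hω => by
    by_contra hc
    exact hω (subset_toMeasurable μ _ hc)
  classical
  let f : Ω → ProbabilityMeasure (A × ℝ) := fun ω => if ω ∈ N then ρ else Θ (itemSeq W η ω)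
  have hf : ∀ ω, f ω ∈ uniformMarginal A := fun ω => by
    simp only [f]; split_ifs with hω
    exacts [hρ, hsub ω hω]
  let Ξ : Ω → uniformMarginal A := fun ω => ⟨f ω, hf ω⟩
  have hΞm : Measurable Ξ :=
    (Measurable.ite hNm measurable_const (hΘ'.comp hZ)).subtype_mk
  have hΞae : ∀ᵐ ω ∂μ, (Ξ ω : ProbabilityMeasure (A × ℝ)) = Θ (itemSeq W η ω) := by
    filter_upwards [measure_eq_zero_iff_ae_notMem.1 hN0] with ω hω
    simp only [Ξ, f, if_neg hω]
  have hgm : Measurable fun ξ : uniformMarginal A =>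
      gewpLaw (ξ : ProbabilityMeasure (A × ℝ)) := measurable_gewpLaw.comp measurable_subtype_coe
  refine ⟨Ξ, hΞm, hgm.comp (comap_measurable Ξ), fun B hB => ?_⟩
  have hpath := h.measurable_path hB
  have hle : MeasurableSpace.comap Ξ inferInstance ≤ ‹MeasurableSpace Ω› := hΞm.comap_le
  have hbm : Measurable fun ξ : uniformMarginal A =>
      ((gewpLaw (ξ : ProbabilityMeasure (A × ℝ)) : Measure (PathSpace A)) B).toReal :=
    (measurable_toReal_apply hB).comp hgm
  have hb1 : ∀ ω, |((gewpLaw (Ξ ω : ProbabilityMeasure (A × ℝ)) :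
      Measure (PathSpace A)) B).toReal| ≤ 1 := fun ω => by
    rw [abs_of_nonneg ENNReal.toReal_nonneg]
    exact measureReal_le_one
  refine ae_eq_condExp_of_forall_setIntegral_eq hle ((integrable_const (1 : ℝ)).indicator hpath)
    (fun s _ _ => (integrable_of_bounded (hbm.comp hΞm) hb1).integrableOn) ?_
    (hbm.comp (comap_measurable Ξ)).stronglyMeasurable.aestronglyMeasurable
  -- Events of `σ(Ξ)` are preimages of sets `C` and agree, up to null sets, with invariant events `Θ
  -- ⁻¹' C` of the items; there the de Finetti identity applies with `T = pathOfSeq ⁻¹' B`.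
  rintro _ ⟨_, ⟨C, hC, rfl⟩, rfl⟩ -
  have hS : MeasurableSet[permField (A × ℝ)] (Θ ⁻¹' C) := hΘ hC
  have hT : MeasurableSet (pathOfSeq ⁻¹' B : Set (ℕ → A × ℝ)) := measurable_pathOfSeq hB
  have hj := hjoint _ hS _ hT
  have hκm : Measurable fun z => iidLaw (Θ z) (pathOfSeq ⁻¹' B) :=
    (Measure.measurable_coe hT).comp (measurable_iidLaw.comp hΘ')
  rw [Measure.map_apply hZ (hT.inter hS.1), setLIntegral_map hS.1 hκm hZ] at hj
  have hset : (Ξ ⁻¹' (Subtype.val ⁻¹' C) : Set Ω) =ᵐ[μ]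
      (itemSeq W η ⁻¹' (Θ ⁻¹' C) : Set Ω) := by
    filter_upwards [hΞae] with ω hω
    refine propext ?_
    change (Ξ ω : ProbabilityMeasure (A × ℝ)) ∈ C ↔ Θ (itemSeq W η ω) ∈ C
    rw [hω]
  have hpathset : (path W η ⁻¹' B : Set Ω) =ᵐ[μ]
      (itemSeq W η ⁻¹' (pathOfSeq ⁻¹' B) : Set Ω) := by
    filter_upwards [h.ae_pathOfSeq_itemSeq] with ω hω
    refine propext ?_
    change path W η ω ∈ B ↔ pathOfSeq (itemSeq W η ω) ∈ B
    rw [hω]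
  have hfin : ∀ᵐ ω ∂μ.restrict (itemSeq W η ⁻¹' (Θ ⁻¹' C)),
      iidLaw (Θ (itemSeq W η ω)) (pathOfSeq ⁻¹' B) < ⊤ :=
    Eventually.of_forall fun ω => measure_lt_top _ _
  have hκm' : Measurable fun ω => iidLaw (Θ (itemSeq W η ω)) (pathOfSeq ⁻¹' B) := hκm.comp hZ
  have hμ : μ (path W η ⁻¹' B ∩ itemSeq W η ⁻¹' (Θ ⁻¹' C)) =
      ∫⁻ ω in itemSeq W η ⁻¹' (Θ ⁻¹' C), iidLaw (Θ (itemSeq W η ω)) (pathOfSeq ⁻¹' B) ∂μ :=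
    (measure_congr (hpathset.inter (ae_eq_refl _))).trans hj
  rw [setIntegral_congr_set hset, setIntegral_congr_set hset, integral_indicator hpath,
    Measure.restrict_restrict hpath, setIntegral_const, smul_eq_mul, mul_one, Measure.real, hμ,
    ← integral_toReal hκm'.aemeasurable hfin]
  refine integral_congr_ae (ae_restrict_of_ae ?_)
  filter_upwards [hΞae] with ω hω
  simp only [hω, gewpLaw, ProbabilityMeasure.coe_mk]
  rw [Measure.map_apply measurable_pathOfSeq hB]

end ErasedWords

end ErasedWord

end

open ErasedWord in
theorem mainTheorem10 {A : Type*} [TopologicalSpace A] [PolishSpace A] [MeasurableSpace A]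
    [BorelSpace A] {Ω : Type*} [MeasurableSpace Ω] (μ : Measure Ω) [IsProbabilityMeasure μ]
    (W : (n : ℕ) → Ω → Fin (n + 1) → A) (η : (n : ℕ) → Ω → Fin (n + 1))
    (hWη : IsGEWP μ W η) :
    ∃ Ξ : Ω → uniformMarginal A,
      IsDirectingMeasure μ W η Ξ ∧
      (∀ Ξ' : Ω → uniformMarginal A, IsDirectingMeasure μ W η Ξ' → Ξ' =ᵐ[μ] Ξ) ∧
      ∀ᵐ ω ∂μ, Tendsto (fun n => wordMeasure (W n ω)) atTop
        (𝓝 (Ξ ω : ProbabilityMeasure (A × ℝ))) := by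
  obtain ⟨Ξ, hΞ⟩ := hWη.exists_isDirectingMeasure
  refine ⟨Ξ, hΞ, fun Ξ' hΞ' => ?_, hΞ.ae_tendsto hWη⟩
  filter_upwards [hΞ.ae_tendsto hWη, hΞ'.ae_tendsto hWη] with ω h h'
  exact Subtype.ext (tendsto_nhds_unique h' h)
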